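/- Let $H$ be a real separable Hilbert space and $Q:H\to H$ a positive self-adjoint trace class operator, with a countable complete orthonormal system $(e_k)$ of eigenvectors, $Qe_k=\lambda_k e_k$. Let $W=(W(t))_{t\in[0,1]}$ be a $Q$-Wiener process on a probability space $(\Omega,\mathcal F,\mathbb P)$: an $H$-valued process with $W(0)=0$ and continuous trajectories almost surely, with independent increments, and such that $W(t)-W(s)$ is Gaussian with law $\mathcal N(0,(t-s)Q)$ for $0\le s\le t\le 1$. For $\varepsilon>0$ let $\mu_\varepsilon(A)=\mathbb P(\sqrt\varepsilon\,W\in A)$ be the law of $\sqrt{\varepsilon}\,W$. Fix $0<\alpha<1/2$ and put $$C^0_\alpha([0,1];H)=\Big\{F:[0,1]\to H:\ F(0)=0,\ \lim_{r\to0}\ \sup_{t\ne s,\,|t-s|<r}\frac{\|F(t)-F(s)\|_H}{|t-s|^\alpha}=0\Big\}.$$ Let $c_0(\alpha)=1$ and $\int_{[0,1]}\chi_0\,df=f(1)-f(0)$, and for $n=2^k+l$ with $k\ge0$, $0\le l\le 2^k-1$ let $c_n(\alpha)=2^{k(\alpha-1/2)+\alpha-1}$ and $$\int_{[0,1]}\chi_n\,df=\sqrt{2^k}\Big[2f\big(\tfrac{2l+1}{2^{k+1}}\big)-f\big(\tfrac{2l+2}{2^{k+1}}\big)-f\big(\tfrac{2l}{2^{k+1}}\big)\Big]$$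 (the integral of the $n$-th Haar function $\chi_n$ with respect to $f$). For $F\in C^0_\alpha([0,1];H)$ set $$\|F\|'_\alpha=\sup_{k,n}\Big|c_n(\alpha)\int_{[0,1]}\chi_n\,d\langle F,e_k\rangle\Big|,\qquad U^\delta_\alpha(F)=\{G\in C^0_\alpha([0,1];H):\|G-F\|'_\alpha<\delta\}.$$ Let $Q^{1/2}e_k=\sqrt{\lambda_k}\,e_k$, and let $H_0=Q^{1/2}H$ carry the norm $\|x\|_{H_0}=\|Q^{-1/2}x\|_H$, where $Q^{-1/2}x$ denotes the preimage of $x$ under $Q^{1/2}$ of minimal norm. Define $$I(F)=\inf\Big\{\tfrac12\int_0^1\|U(s)\|_{H_0}^2\,ds:\ U\in L^2([0,1];H_0),\ F(\cdot)=\int_0^{\cdot}U(s)\,ds\Big\}\in[0,\infty],\qquad \inf\emptyset=\infty.$$ Then for every $F\in C^0_\alpha([0,1];H)$ and every $\delta>0$, $$\lim_{\varepsilon\to0}\varepsilon\log\mu_\varepsilon\big(U^\delta_\alpha(F)\big)=-\inf_{G\in U^\delta_\alpha(F)}I(G)$$ in $[-\infty,0]$, where $\log 0=-\infty$. -/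

import Mathlib

open Set Filter Topology MeasureTheory ProbabilityTheory
open scoped ENNReal NNReal unitInterval InnerProductSpace

universe u v

noncomputable section

/-- A bounded positive self-adjoint operator `Q` on `H` is of trace class: the trace
`∑ k, ⟪Q b_k, b_k⟫` converges for every complete orthonormal system `b` of `H`. -/
def IsPositiveTraceClass {H : Type u} [NormedAddCommGroup H] [InnerProductSpace ℝ H]
    [CompleteSpace H] (Q : H →L[ℝ] H) : Prop :=
  Q.IsPositive ∧ ∀ (κ : Type v) (b : HilbertBasis κ ℝ H), Summable fun k => ⟪Q (b k), b k⟫_ℝ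

/-- The random variable `X` has the Gaussian law `N(m, Q)` under `P`:
`E[exp (i ⟨h, X⟩)] = exp (i ⟨h, m⟩ - ⟨Q h, h⟩ / 2)` for all `h`. -/
def HasGaussianLawWith {H : Type*} [NormedAddCommGroup H] [InnerProductSpace ℝ H]
    [MeasurableSpace H] {Ω : Type*} [MeasurableSpace Ω]
    (X : Ω → H) (m : H) (Q : H →L[ℝ] H) (P : Measure Ω) : Prop :=
  AEMeasurable X P ∧ ∀ h : H,
    ∫ ω, Complex.exp (Complex.I * (⟪h, X ω⟫_ℝ : ℂ)) ∂P =
      Complex.exp (Complex.I * (⟪h, m⟫_ℝ : ℂ) - (1 / 2 : ℂ) * (⟪Q h, h⟫_ℝ : ℂ))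

/-- `W` is a `Q`-Wiener process on the time interval `[0, 1]`. -/
structure IsQWienerProcess {H : Type*} [NormedAddCommGroup H] [InnerProductSpace ℝ H]
    [MeasurableSpace H] {Ω : Type*} [MeasurableSpace Ω]
    (Q : H →L[ℝ] H) (W : I → Ω → H) (P : Measure Ω) : Prop where
  measurable : ∀ t, Measurable (W t)
  zero : ∀ᵐ ω ∂P, W 0 ω = 0
  continuous : ∀ᵐ ω ∂P, Continuous fun t => W t ω
  indepIncrements : HasIndepIncrements W P
  gaussianIncrements : ∀ s t : I, s ≤ t →
    HasGaussianLawWith (fun ω => W t ω - W s ω) 0 (((t : ℝ) - (s : ℝ)) • Q) P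

/-- `μ_ε(A) = P(√ε W ∈ A)`, for a set `A` of paths. -/
def scaledLaw {H : Type*} [NormedAddCommGroup H] [InnerProductSpace ℝ H]
    {Ω : Type*} [MeasurableSpace Ω] (W : I → Ω → H) (P : Measure Ω) (ε : ℝ)
    (A : Set (I → H)) : ℝ≥0∞ :=
  P {ω | (fun t => √ε • W t ω) ∈ A}

/-- The space `C_α^0([0,1]; H)`: functions with `F 0 = 0` and
`sup {‖F t - F s‖ / |t - s| ^ α : t ≠ s, |t - s| < r} → 0` as `r → 0`. -/
def holderZero (H : Type*) [NormedAddCommGroup H] (α : ℝ) : Set (I → H) :=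
  {F | F 0 = 0 ∧ ∀ η : ℝ, 0 < η → ∃ r : ℝ, 0 < r ∧
    ∀ s t : I, t ≠ s → |(t : ℝ) - (s : ℝ)| < r →
      ‖F t - F s‖ / |(t : ℝ) - (s : ℝ)| ^ α ≤ η}

/-- The dyadic point `j / 2 ^ m` of `[0, 1]`, for `j ≤ 2 ^ m`. -/
def dyadicPoint (j m : ℕ) : I :=
  Set.projIcc (0 : ℝ) 1 zero_le_one ((j : ℝ) / 2 ^ m)

/-- The integral `∫_{[0,1]} χ_n dF` of the `n`-th Haar function. Here `χ_0 = 1` and, for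
`n = 2 ^ k + l` with `0 ≤ l < 2 ^ k`, the function `χ_n` is the step function with value `√(2 ^ k)`
on `[2l / 2^(k+1), (2l+1) / 2^(k+1))`, value `-√(2 ^ k)` on
`[(2l+1) / 2^(k+1), (2l+2) / 2^(k+1)]`, and `0` elsewhere. -/
def haarIntegral {E : Type*} [NormedAddCommGroup E] [NormedSpace ℝ E] (F : I → E) (n : ℕ) : E :=
  if n = 0 then F 1 - F 0
  else
    let k := Nat.log 2 n
    let l := n - 2 ^ k
    √((2 : ℝ) ^ k) • (F (dyadicPoint (2 * l + 1) (k + 1)) - F (dyadicPoint (2 * l) (k + 1))) -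
      √((2 : ℝ) ^ k) • (F (dyadicPoint (2 * l + 2) (k + 1)) - F (dyadicPoint (2 * l + 1) (k + 1)))

/-- The constants `c_0(α) = 1` and `c_n(α) = 2 ^ (k (α - 1/2) + α - 1)` for `n = 2 ^ k + l`,
`0 ≤ l < 2 ^ k`. -/
def haarWeight (α : ℝ) (n : ℕ) : ℝ :=
  if n = 0 then 1 else (2 : ℝ) ^ ((Nat.log 2 n : ℝ) * (α - 1 / 2) + α - 1)

/-- The norm `‖F‖'_α = sup_{k,n} |c_n(α) ∫ χ_n d⟨F, e_k⟩|`, with values in `[0, ∞]`. -/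
def coarseNorm {H : Type*} [NormedAddCommGroup H] [InnerProductSpace ℝ H] {ι : Type*}
    (e : HilbertBasis ι ℝ H) (α : ℝ) (F : I → H) : ℝ≥0∞ :=
  ⨆ (k : ι) (n : ℕ),
    ENNReal.ofReal |haarWeight α n * haarIntegral (fun t => ⟪F t, e k⟫_ℝ) n|

/-- The open ball `U_α^δ(F)` of `C_α^0([0,1]; H)` in the norm `‖·‖'_α`. -/
def coarseBall {H : Type*} [NormedAddCommGroup H] [InnerProductSpace ℝ H] {ι : Type*}
    (e : HilbertBasis ι ℝ H) (α δ : ℝ) (F : I → H) : Set (I → H) :=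
  {G | G ∈ holderZero H α ∧ coarseNorm e α (G - F) < ENNReal.ofReal δ}

/-- The operator `Q^{1/2}`, given by `Q^{1/2} e_k = √λ_k e_k`, where `Q e_k = λ_k e_k`. -/
def sqrtOperator {H : Type*} [NormedAddCommGroup H] [InnerProductSpace ℝ H] {ι : Type*}
    (e : HilbertBasis ι ℝ H) (lam : ι → ℝ) (x : H) : H :=
  ∑' k, (√(lam k) * ⟪x, e k⟫_ℝ) • e k

/-- The norm `‖x‖_0 = ‖Q^{-1/2} x‖` of the space `H_0 = Q^{1/2} H`, where `Q^{-1/2} x` is the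
preimage of `x` under `Q^{1/2}` of least norm; it is `∞` for `x` outside `H_0`. -/
def cameronMartinNorm {H : Type*} [NormedAddCommGroup H] [InnerProductSpace ℝ H] {ι : Type*}
    (e : HilbertBasis ι ℝ H) (lam : ι → ℝ) (x : H) : ℝ≥0∞ :=
  ⨅ (y : H) (_ : sqrtOperator e lam y = x), ‖y‖ₑ

/-- `U ∈ L²([0,1]; H_0)`. (Only the values of `U` on `[0,1]` matter.) -/
def MemL2CameronMartin {H : Type*} [NormedAddCommGroup H] [InnerProductSpace ℝ H]
    [MeasurableSpace H] {ι : Type*} (e : HilbertBasis ι ℝ H) (lam : ι → ℝ) (U : ℝ → H) : Prop :=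
  Measurable U ∧ (∀ s ∈ Icc (0 : ℝ) 1, U s ∈ range (sqrtOperator e lam)) ∧
    ∫⁻ s in Icc (0 : ℝ) 1, cameronMartinNorm e lam (U s) ^ 2 < ∞

/-- The rate function `I(F) = inf {½ ∫_0^1 ‖U s‖_0² ds : U ∈ L²([0,1]; H_0), F = ∫_0^· U s ds}`,
with `inf ∅ = ∞`. -/
def rateFunction {H : Type*} [NormedAddCommGroup H] [InnerProductSpace ℝ H]
    [MeasurableSpace H] {ι : Type*} (e : HilbertBasis ι ℝ H) (lam : ι → ℝ) (F : I → H) : ℝ≥0∞ :=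
  ⨅ (U : ℝ → H) (_ : MemL2CameronMartin e lam U)
    (_ : ∀ t : I, F t = ∫ s in (0 : ℝ)..(t : ℝ), U s),
    (1 / 2 : ℝ≥0∞) * ∫⁻ s in Icc (0 : ℝ) 1, cameronMartinNorm e lam (U s) ^ 2

end

/-!
Three facts turn the large deviation limit into a statement about finitely many independent real
Gaussian variables.

* For `G ∈ C_α^0` the weighted Haar coefficients `c_n(α) ∫ χ_n d⟨G, e_k⟩` tend to zero along
  `(k, n)` (`finite_setOf_le_haarCoeff`). Hence their supremum is less than `δ` if and only if each
  of them is, and the ball about `F` is cut out by one condition on each coefficient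
  (`mem_coarseBall_iff`).
* The Haar coefficients of `W` are independent, the one with index `(k, n)` being centred Gaussian
  of variance `λ_k` (`IsQWienerProcess.iIndepFun_haarCoeff`, `IsQWienerProcess.map_haarCoeff`). They
  are integrals of orthonormal step functions against the process, so that this only needs the
  independence and the law of the increments.
* The trajectories of `W` lie in `C_α^0` almost surely (`IsQWienerProcess.ae_mem_holderZero`):
  by Fernique's theorem and scaling `E ‖W t - W s‖ ^ p` is a multiple of `|t - s| ^ (p / 2)`, and
  chaining along dyadic points gives Hölder continuity of some exponent larger than `α`.

Let `S` be the finite set of indices at which the weighted coefficient of `F` is at least `δ / 2`.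
The probability of the ball is at most the product over `S` of the probabilities of the individual
conditions. It is at least half of that product for small `ε`: by the third fact the weighted
coefficients of `W` outside `S` are at most some `N` with probability at least `1 / 2`, this event
is independent of the coefficients in `S`, and on it the conditions outside `S` hold as soon as
`√ε N < δ / 2`. So the limit is the sum over `S` of the limits for one real Gaussian variable
(`tendsto_mul_log_gaussianReal`), namely of
`-(max (|f_p| - δ / w_p) 0)² / (2 λ_k)`, where `f_p` and `w_p` are the coefficient of `F` and the
weight at `p = (k, n)`.

The infimum of the rate function over the ball has the same value
(`iInf_rateFunction_coarseBall`): Bessel's inequality bounds the energy of a path from below by half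
the sum of the squares of its coefficients divided by `λ_k`, and a finite Haar sum with coefficients
slightly inside the allowed intervals comes arbitrarily close. If `λ_k = 0` for some index at which
the weighted coefficient of `F` is at least `δ`, then the ball has probability zero and contains no
path of finite energy, and both sides are `-∞`.
-/

/-! ### Haar functions -/

/-- The `n`-th Haar function on `[0, 1)`: `χ_0 = 1`, and for `n = 2 ^ k + l` with `l < 2 ^ k` the
value at `s` is `√(2 ^ k)`, `-√(2 ^ k)` or `0` according to the index `⌊2 ^ (k + 1) s⌋` of the
dyadic interval of length `2 ^ -(k + 1)` that contains `s`. -/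
noncomputable def haarFun (n : ℕ) (s : ℝ) : ℝ :=
  if n = 0 then 1
  else
    let k := Nat.log 2 n
    let l := n - 2 ^ k
    if ⌊(2 : ℝ) ^ (k + 1) * s⌋ = (2 * l : ℕ) then √((2 : ℝ) ^ k)
    else if ⌊(2 : ℝ) ^ (k + 1) * s⌋ = (2 * l + 1 : ℕ) then -√((2 : ℝ) ^ k) else 0

theorem coe_dyadicPoint {j m : ℕ} (h : j ≤ 2 ^ m) : (dyadicPoint j m : ℝ) = (j : ℝ) / 2 ^ m := by
  have h' : (j : ℝ) ≤ 2 ^ m := by exact_mod_cast h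
  rw [dyadicPoint, projIcc_of_mem zero_le_one
    ⟨by positivity, by rw [div_le_one (by positivity)]; exact h'⟩]

/-- The index of a dyadic interval of level `log₂ n` is smaller than the number of such
intervals. -/
theorem haar_index_lt {n : ℕ} (hn : n ≠ 0) : n - 2 ^ Nat.log 2 n + 1 ≤ 2 ^ Nat.log 2 n := by
  have h1 := Nat.pow_log_le_self 2 hn
  have h2 := Nat.lt_pow_succ_log_self (b := 2) (by norm_num) n
  rw [pow_succ] at h2
  omega

theorem measurable_haarFun (n : ℕ) : Measurable (haarFun n) := by
  unfold haarFun
  split_ifs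
  · fun_prop
  · refine Measurable.ite ?_ measurable_const (Measurable.ite ?_ measurable_const measurable_const)
    all_goals
      exact (Int.measurable_floor.comp (measurable_const.mul measurable_id))
        (measurableSet_singleton _)

theorem abs_haarFun_le (n : ℕ) (s : ℝ) : |haarFun n s| ≤ √((2 : ℝ) ^ Nat.log 2 n) := by
  unfold haarFun
  dsimp only
  split_ifs with h
  · simp [h]
  · rw [abs_of_nonneg (by positivity)]
  · rw [abs_neg, abs_of_nonneg (by positivity)]
  · simp

theorem intervalIntegrable_haarFun_mul {u : ℝ → ℝ} {a b : ℝ} (hu : IntervalIntegrable u volume a b)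
    (n : ℕ) : IntervalIntegrable (fun s => haarFun n s * u s) volume a b := by
  rw [intervalIntegrable_iff] at hu ⊢
  exact hu.bdd_mul (measurable_haarFun n).aestronglyMeasurable
    (ae_of_all _ fun s => (abs_haarFun_le n s))

theorem floor_pow_two_mul_eq {m j : ℕ} {s : ℝ} (h1 : (j : ℝ) / 2 ^ m ≤ s)
    (h2 : s < ((j + 1 : ℕ) : ℝ) / 2 ^ m) : ⌊(2 : ℝ) ^ m * s⌋ = j := by
  rw [div_le_iff₀ (by positivity)] at h1
  rw [lt_div_iff₀ (by positivity)] at h2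
  rw [Int.floor_eq_iff]
  push_cast at h2 ⊢
  constructor <;> linarith

/-- Integration against a Haar function is the difference of the integrals over the two halves of
its support. -/
theorem integral_haarFun_mul {n : ℕ} (hn : n ≠ 0) {u : ℝ → ℝ}
    (hu : IntervalIntegrable u volume 0 1) :
    ∫ s in (0 : ℝ)..1, haarFun n s * u s =
      √((2 : ℝ) ^ Nat.log 2 n) *
        ((∫ s in ((2 * (n - 2 ^ Nat.log 2 n) : ℕ) : ℝ) / 2 ^ (Nat.log 2 n + 1)..
            ((2 * (n - 2 ^ Nat.log 2 n) + 1 : ℕ) : ℝ) / 2 ^ (Nat.log 2 n + 1), u s) -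
          ∫ s in ((2 * (n - 2 ^ Nat.log 2 n) + 1 : ℕ) : ℝ) / 2 ^ (Nat.log 2 n + 1)..
            ((2 * (n - 2 ^ Nat.log 2 n) + 2 : ℕ) : ℝ) / 2 ^ (Nat.log 2 n + 1), u s) := by
  have hl := haar_index_lt hn
  set k := Nat.log 2 n with hk
  set l := n - 2 ^ k with hl'
  set a : ℝ := ((2 * l : ℕ) : ℝ) / 2 ^ (k + 1) with ha
  set b : ℝ := ((2 * l + 1 : ℕ) : ℝ) / 2 ^ (k + 1) with hb
  set c : ℝ := ((2 * l + 2 : ℕ) : ℝ) / 2 ^ (k + 1) with hc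
  have ha0 : 0 ≤ a := by positivity
  have hab : a ≤ b := by
    rw [ha, hb]; gcongr; omega
  have hbc : b ≤ c := by
    rw [hb, hc]; gcongr; omega
  have hc1 : c ≤ 1 := by
    rw [hc, div_le_one (by positivity)]
    have : 2 * l + 2 ≤ 2 ^ (k + 1) := by rw [pow_succ]; omega
    exact_mod_cast this
  have hint : ∀ x y : ℝ, 0 ≤ x → x ≤ y → y ≤ 1 → IntervalIntegrable u volume x y := by
    intro x y hx hxy hy
    refine hu.mono_set ?_
    rw [uIcc_of_le hxy, uIcc_of_le zero_le_one]
    exact Icc_subset_Icc hx hy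
  have hint' := fun x y hx hxy hy => intervalIntegrable_haarFun_mul (hint x y hx hxy hy) n
  have hval : ∀ s, haarFun n s = if ⌊(2 : ℝ) ^ (k + 1) * s⌋ = (2 * l : ℕ) then √((2 : ℝ) ^ k)
    else if ⌊(2 : ℝ) ^ (k + 1) * s⌋ = (2 * l + 1 : ℕ) then -√((2 : ℝ) ^ k) else 0 := by
    intro s; simp only [haarFun, hn, if_false]; rfl
  rw [← intervalIntegral.integral_add_adjacent_intervals (hint' 0 a le_rfl ha0 (by linarith))
      (hint' a 1 ha0 (by linarith) le_rfl),
    ← intervalIntegral.integral_add_adjacent_intervals (hint' a b ha0 hab (by linarith))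
      (hint' b 1 (by linarith) (by linarith) le_rfl),
    ← intervalIntegral.integral_add_adjacent_intervals (hint' b c (by linarith) hbc hc1)
      (hint' c 1 (by linarith) hc1 le_rfl)]
  have e1 : ∫ s in (0 : ℝ)..a, haarFun n s * u s = 0 := by
    rw [intervalIntegral.integral_congr_Ioo_of_le (g := fun _ => 0) ha0]
    · simp
    · intro s hs
      have hs2 : ⌊(2 : ℝ) ^ (k + 1) * s⌋ < (2 * l : ℕ) := by
        rw [Int.floor_lt]
        have := hs.2
        rw [ha, lt_div_iff₀ (by positivity)] at this
        push_cast at this ⊢; linarith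
      simp only [hval]
      rw [if_neg (by omega), if_neg (by push_cast at hs2 ⊢; omega), zero_mul]
  have e2 : ∫ s in a..b, haarFun n s * u s = √((2 : ℝ) ^ k) * ∫ s in a..b, u s := by
    rw [← intervalIntegral.integral_const_mul]
    refine intervalIntegral.integral_congr_Ioo_of_le hab ?_
    intro s hs
    simp only [hval]
    rw [if_pos (floor_pow_two_mul_eq hs.1.le hs.2)]
  have e3 : ∫ s in b..c, haarFun n s * u s = -√((2 : ℝ) ^ k) * ∫ s in b..c, u s := by
    rw [← intervalIntegral.integral_const_mul]
    refine intervalIntegral.integral_congr_Ioo_of_le hbc ?_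
    intro s hs
    have := floor_pow_two_mul_eq hs.1.le hs.2
    simp only [hval]
    rw [if_neg (by rw [this]; push_cast; omega), if_pos this]
  have e4 : ∫ s in c..(1 : ℝ), haarFun n s * u s = 0 := by
    rw [intervalIntegral.integral_congr_Ioo_of_le (g := fun _ => 0) hc1]
    · simp
    · intro s hs
      have hs2 : ((2 * l + 2 : ℕ) : ℤ) ≤ ⌊(2 : ℝ) ^ (k + 1) * s⌋ := by
        rw [Int.le_floor]
        have := hs.1
        rw [hc, div_lt_iff₀ (by positivity)] at this
        push_cast at this ⊢; linarith
      simp only [hval]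
      rw [if_neg (by push_cast at hs2 ⊢; omega), if_neg (by push_cast at hs2 ⊢; omega), zero_mul]
  rw [e1, e2, e3, e4]
  ring

theorem haarIntegral_primitive {u : ℝ → ℝ} (hu : IntervalIntegrable u volume 0 1) (n : ℕ) :
    haarIntegral (fun t : I => ∫ s in (0 : ℝ)..(t : ℝ), u s) n =
      ∫ s in (0 : ℝ)..1, haarFun n s * u s := by
  by_cases hn : n = 0
  · simp [haarIntegral, haarFun, hn]
  · rw [integral_haarFun_mul hn hu]
    have hl := haar_index_lt hn
    have h2 : 2 * (n - 2 ^ Nat.log 2 n) + 2 ≤ 2 ^ (Nat.log 2 n + 1) := by rw [pow_succ]; omega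
    have key : ∀ i j : ℕ, i ≤ 2 ^ (Nat.log 2 n + 1) → j ≤ 2 ^ (Nat.log 2 n + 1) →
        (∫ s in (0 : ℝ)..(dyadicPoint j (Nat.log 2 n + 1) : ℝ), u s) -
          (∫ s in (0 : ℝ)..(dyadicPoint i (Nat.log 2 n + 1) : ℝ), u s) =
        ∫ s in (i : ℝ) / 2 ^ (Nat.log 2 n + 1)..(j : ℝ) / 2 ^ (Nat.log 2 n + 1), u s := by
      intro i j hi hj
      rw [← coe_dyadicPoint hi, ← coe_dyadicPoint hj]
      have hint : ∀ t : I, IntervalIntegrable u volume 0 (t : ℝ) := fun t => by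
        refine hu.mono_set ?_
        rw [uIcc_of_le t.2.1, uIcc_of_le zero_le_one]
        exact Icc_subset_Icc le_rfl t.2.2
      exact intervalIntegral.integral_interval_sub_left (hint _) (hint _)
    simp only [haarIntegral, hn, if_false, smul_eq_mul]
    rw [key _ _ (by omega) (by omega), key _ _ (by omega) (by omega)]
    ring

theorem intervalIntegrable_haarFun (n : ℕ) (a b : ℝ) :
    IntervalIntegrable (haarFun n) volume a b := by
  simpa using intervalIntegrable_haarFun_mul (u := fun _ => 1) intervalIntegrable_const n

theorem integral_haarFun {n : ℕ} (hn : n ≠ 0) : ∫ s in (0 : ℝ)..1, haarFun n s = 0 := by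
  have := integral_haarFun_mul hn (u := fun _ => 1) intervalIntegrable_const
  simp only [mul_one, intervalIntegral.integral_const, smul_eq_mul] at this
  rw [this]
  push_cast
  ring

/-- On the support of a Haar function every preceding Haar function is constant. -/
theorem exists_haarFun_mul_eq {m n : ℕ} (h : m < n) :
    ∃ c : ℝ, ∀ s, haarFun m s * haarFun n s = c * haarFun n s := by
  by_cases hm : m = 0
  · exact ⟨1, fun s => by simp [haarFun, hm]⟩
  have hn : n ≠ 0 := by omega
  have hlog : Nat.log 2 m ≤ Nat.log 2 n := Nat.log_mono_right h.le
  have hm1 := Nat.pow_log_le_self 2 hm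
  have hn1 := Nat.pow_log_le_self 2 hn
  obtain heq | hlt := hlog.eq_or_lt
  · refine ⟨0, fun s => ?_⟩
    simp only [haarFun, hm, hn, if_false, heq]
    rw [heq] at hm1
    split_ifs <;> first | (exfalso; omega) | simp
  · set k := Nat.log 2 n with hk
    set l := n - 2 ^ k with hl
    set k' := Nat.log 2 m with hk'
    obtain ⟨d, hd⟩ : ∃ d, k + 1 = (k' + 1) + (d + 1) := ⟨k - k' - 1, by omega⟩
    -- the index of the coarser dyadic interval is determined by that of the finer one
    have hfl : ∀ s : ℝ, ⌊(2 : ℝ) ^ (k' + 1) * s⌋ = ⌊(2 : ℝ) ^ (k + 1) * s⌋ / (2 ^ (d + 1) : ℕ) := by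
      intro s
      rw [← Int.floor_div_natCast, hd, pow_add _ (k' + 1)]
      congr 1
      push_cast
      field_simp
    have hidx : ∀ s : ℝ, ⌊(2 : ℝ) ^ (k + 1) * s⌋ = (2 * l : ℕ) ∨
        ⌊(2 : ℝ) ^ (k + 1) * s⌋ = (2 * l + 1 : ℕ) →
        ⌊(2 : ℝ) ^ (k' + 1) * s⌋ = (l : ℤ) / (2 ^ d : ℕ) := by
      intro s hs
      rw [hfl, show (2 ^ (d + 1) : ℕ) = 2 * 2 ^ d from pow_succ' 2 d, Nat.cast_mul,
        ← Int.ediv_ediv_of_nonneg (by norm_num)]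
      congr 1
      rcases hs with hs | hs <;> rw [hs] <;> push_cast <;> omega
    refine ⟨if (l : ℤ) / (2 ^ d : ℕ) = (2 * (m - 2 ^ k') : ℕ) then √((2 : ℝ) ^ k')
      else if (l : ℤ) / (2 ^ d : ℕ) = (2 * (m - 2 ^ k') + 1 : ℕ) then -√((2 : ℝ) ^ k') else 0,
      fun s => ?_⟩
    by_cases hs : ⌊(2 : ℝ) ^ (k + 1) * s⌋ = (2 * l : ℕ) ∨ ⌊(2 : ℝ) ^ (k + 1) * s⌋ = (2 * l + 1 : ℕ)
    · congr 1
      simp only [haarFun, hm, if_false]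
      rw [← hk', hidx s hs]
    · rw [not_or] at hs
      have : haarFun n s = 0 := by
        simp only [haarFun, hn, if_false]
        rw [← hk, ← hl, if_neg hs.1, if_neg hs.2]
      simp [this]

/-- The Haar functions are orthonormal in `L²([0, 1])`. -/
theorem integral_haarFun_mul_haarFun (m n : ℕ) :
    ∫ s in (0 : ℝ)..1, haarFun m s * haarFun n s = if m = n then 1 else 0 := by
  have off : ∀ {m n : ℕ}, m < n → ∫ s in (0 : ℝ)..1, haarFun m s * haarFun n s = 0 := by
    intro m n h
    obtain ⟨c, hc⟩ := exists_haarFun_mul_eq h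
    simp_rw [hc]
    rw [intervalIntegral.integral_const_mul, integral_haarFun (by omega), mul_zero]
  rcases lt_trichotomy m n with h | rfl | h
  · rw [off h, if_neg h.ne]
  · rw [if_pos rfl]
    by_cases hm : m = 0
    · simp [haarFun, hm]
    · rw [integral_haarFun_mul hm (intervalIntegrable_haarFun m 0 1)]
      have hval : ∀ s, haarFun m s = if ⌊(2 : ℝ) ^ (Nat.log 2 m + 1) * s⌋ =
            (2 * (m - 2 ^ Nat.log 2 m) : ℕ) then √((2 : ℝ) ^ Nat.log 2 m)
          else if ⌊(2 : ℝ) ^ (Nat.log 2 m + 1) * s⌋ = (2 * (m - 2 ^ Nat.log 2 m) + 1 : ℕ)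
            then -√((2 : ℝ) ^ Nat.log 2 m) else 0 := by
        intro s; simp only [haarFun, hm, if_false]
      generalize m - 2 ^ Nat.log 2 m = l at *
      generalize Nat.log 2 m = k at *
      have e1 : ∫ s in ((2 * l : ℕ) : ℝ) / 2 ^ (k + 1)..((2 * l + 1 : ℕ) : ℝ) / 2 ^ (k + 1),
          haarFun m s = ∫ s in ((2 * l : ℕ) : ℝ) / 2 ^ (k + 1)..((2 * l + 1 : ℕ) : ℝ) / 2 ^ (k + 1),
            √((2 : ℝ) ^ k) := by
        refine intervalIntegral.integral_congr_Ioo_of_le (by gcongr; omega) fun s hs => ?_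
        rw [hval, if_pos (floor_pow_two_mul_eq hs.1.le hs.2)]
      have e2 : ∫ s in ((2 * l + 1 : ℕ) : ℝ) / 2 ^ (k + 1)..((2 * l + 2 : ℕ) : ℝ) / 2 ^ (k + 1),
          haarFun m s =
          ∫ s in ((2 * l + 1 : ℕ) : ℝ) / 2 ^ (k + 1)..((2 * l + 2 : ℕ) : ℝ) / 2 ^ (k + 1),
            -√((2 : ℝ) ^ k) := by
        refine intervalIntegral.integral_congr_Ioo_of_le (by gcongr; omega) fun s hs => ?_
        have := floor_pow_two_mul_eq hs.1.le hs.2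
        rw [hval, if_neg (by rw [this]; push_cast; omega), if_pos this]
      rw [e1, e2]
      simp only [intervalIntegral.integral_const, smul_eq_mul]
      have := Real.mul_self_sqrt (show (0 : ℝ) ≤ 2 ^ k by positivity)
      calc _ = (√((2 : ℝ) ^ k) * √((2 : ℝ) ^ k)) * (2 / 2 ^ (k + 1)) := by push_cast; ring
        _ = 1 := by rw [this, pow_succ]; field_simp
  · simp_rw [mul_comm (haarFun m _)]
    rw [off h, if_neg h.ne']

/-! ### Haar coefficients and Hölder spaces -/

section Hoelder

variable {H : Type*} [NormedAddCommGroup H]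

theorem sub_mem_holderZero {α : ℝ} {F G : I → H} (hF : F ∈ holderZero H α)
    (hG : G ∈ holderZero H α) : G - F ∈ holderZero H α := by
  refine ⟨by simp [hF.1, hG.1], fun η hη => ?_⟩
  obtain ⟨r₁, hr₁, h₁⟩ := hF.2 (η / 2) (by positivity)
  obtain ⟨r₂, hr₂, h₂⟩ := hG.2 (η / 2) (by positivity)
  refine ⟨min r₁ r₂, lt_min hr₁ hr₂, fun s t hst hd => ?_⟩
  have a₁ := h₁ s t hst (hd.trans_le (min_le_left _ _))
  have a₂ := h₂ s t hst (hd.trans_le (min_le_right _ _))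
  have : ‖(G - F) t - (G - F) s‖ ≤ ‖G t - G s‖ + ‖F t - F s‖ := by
    rw [Pi.sub_apply, Pi.sub_apply, sub_sub_sub_comm]
    exact norm_sub_le _ _
  calc _ ≤ (‖G t - G s‖ + ‖F t - F s‖) / |(t : ℝ) - s| ^ α := by gcongr
    _ ≤ η := by rw [add_div]; linarith

/-- Hölder continuity with a larger exponent gives membership in `C_α^0`. -/
theorem mem_holderZero_of_holder {α β C : ℝ} (hαβ : α < β) {F : I → H} (h0 : F 0 = 0)
    (hF : ∀ s t : I, s < t → ‖F t - F s‖ ≤ C * ((t : ℝ) - s) ^ β) : F ∈ holderZero H α := by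
  refine ⟨h0, fun η hη => ?_⟩
  have hc : Tendsto (fun x : ℝ => C * x ^ (β - α)) (𝓝 0) (𝓝 0) := by
    have : ContinuousAt (fun x : ℝ => C * x ^ (β - α)) 0 :=
      continuousAt_const.mul (Real.continuousAt_rpow_const _ _ (Or.inr (by linarith)))
    have h := this.tendsto
    rwa [Real.zero_rpow (by linarith), mul_zero] at h
  obtain ⟨r, hr, hr'⟩ := Metric.eventually_nhds_iff.1 (hc.eventually (gt_mem_nhds hη))
  refine ⟨r, hr, ?_⟩
  have key : ∀ s t : I, s < t → |(t : ℝ) - s| < r → ‖F t - F s‖ / |(t : ℝ) - s| ^ α ≤ η := by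
    intro s t hst hd
    have hpos : 0 < (t : ℝ) - s := sub_pos.2 hst
    rw [abs_of_pos hpos] at hd ⊢
    have h1 : C * ((t : ℝ) - s) ^ (β - α) < η :=
      hr' (by rw [Real.dist_eq, sub_zero, abs_of_pos hpos]; exact hd)
    rw [div_le_iff₀ (by positivity)]
    refine (hF s t hst).trans ?_
    have h2 : ((t : ℝ) - s) ^ β = ((t : ℝ) - s) ^ (β - α) * ((t : ℝ) - s) ^ α := by
      rw [← Real.rpow_add hpos]; ring_nf
    rw [h2, ← mul_assoc]
    gcongr
  intro s t hst hd
  rcases lt_or_gt_of_ne hst with h | h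
  · rw [norm_sub_rev, abs_sub_comm]
    exact key t s h (by rwa [abs_sub_comm])
  · exact key s t h hd

/-- The dyadic approximation of level `m` of a point of `[0, 1]` from below. -/
noncomputable def dyadicFloor (m : ℕ) (t : I) : I := dyadicPoint ⌊(2 : ℝ) ^ m * t⌋₊ m

theorem floor_two_pow_mul_le (m : ℕ) (t : I) : ⌊(2 : ℝ) ^ m * t⌋₊ ≤ 2 ^ m := by
  have : (2 : ℝ) ^ m * t ≤ 2 ^ m := by
    have := t.2.2
    have h2 : (0 : ℝ) < 2 ^ m := by positivity
    nlinarith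
  calc _ ≤ ⌊((2 ^ m : ℕ) : ℝ)⌋₊ := Nat.floor_mono (by push_cast; exact this)
    _ = 2 ^ m := Nat.floor_natCast _

theorem tendsto_dyadicFloor (t : I) : Tendsto (fun m => dyadicFloor m t) atTop (𝓝 t) := by
  rw [tendsto_subtype_rng]
  have h : ∀ m : ℕ, |(dyadicFloor m t : ℝ) - t| ≤ (1 / 2) ^ m := by
    intro m
    rw [dyadicFloor, coe_dyadicPoint (floor_two_pow_mul_le m t)]
    have ht := t.2.1
    have h1 := Nat.floor_le (show 0 ≤ (2 : ℝ) ^ m * t by positivity)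
    have h2 := Nat.lt_floor_add_one ((2 : ℝ) ^ m * t)
    have h3 : ((⌊(2 : ℝ) ^ m * t⌋₊ : ℝ) / 2 ^ m) - t =
        (⌊(2 : ℝ) ^ m * t⌋₊ - 2 ^ m * t) / 2 ^ m := by
      field_simp
    rw [h3, abs_div, abs_of_pos (show (0 : ℝ) < 2 ^ m by positivity), one_div_pow]
    gcongr
    rw [abs_le]; constructor <;> linarith
  rw [tendsto_iff_dist_tendsto_zero]
  refine squeeze_zero (fun _ => dist_nonneg) (fun m => ?_)
    (tendsto_pow_atTop_nhds_zero_of_lt_one (r := (1 / 2 : ℝ)) (by norm_num) (by norm_num))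
  rw [Real.dist_eq]; exact h m

/-- Chaining: a continuous path whose increments over dyadic intervals of length `2 ^ -m` are at
most of order `2 ^ (-β m)` is `β`-Hölder. -/
theorem exists_holder_of_dyadic {β K : ℝ} (hβ : 0 < β) {F : I → H} (hF : Continuous F)
    (hK : ∀ m j : ℕ, j < 2 ^ m →
      ‖F (dyadicPoint (j + 1) m) - F (dyadicPoint j m)‖ ≤ K * ((2 : ℝ) ^ (-β)) ^ m) :
    ∃ C : ℝ, ∀ s t : I, s < t → ‖F t - F s‖ ≤ C * ((t : ℝ) - s) ^ β := by
  set ρ : ℝ := (2 : ℝ) ^ (-β) with hρ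
  have hρ0 : 0 < ρ := by positivity
  have hρ1 : ρ < 1 := Real.rpow_lt_one_of_one_lt_of_neg (by norm_num) (by linarith)
  have hK0 : 0 ≤ K := by
    have := (norm_nonneg _).trans (hK 0 0 (by norm_num))
    simpa using this
  have hsame : ∀ (t : I) (m : ℕ), dist (F (dyadicFloor m t)) (F (dyadicFloor (m + 1) t)) ≤
      (K * ρ) * ρ ^ m := by
    intro t m
    have ht := t.2.1
    set j := ⌊(2 : ℝ) ^ m * t⌋₊ with hj
    have hj1 : j ≤ 2 ^ m := floor_two_pow_mul_le m t
    have hj' : ⌊(2 : ℝ) ^ (m + 1) * t⌋₊ ≤ 2 ^ (m + 1) := floor_two_pow_mul_le (m + 1) t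
    have hdiv : ⌊(2 : ℝ) ^ (m + 1) * t⌋₊ / 2 = j := by
      rw [← Nat.floor_div_natCast, hj]
      congr 1
      push_cast
      rw [pow_succ]
      ring
    have heq : dyadicPoint j m = dyadicPoint (2 * j) (m + 1) := by
      apply Subtype.ext
      rw [coe_dyadicPoint hj1, coe_dyadicPoint (by rw [pow_succ]; omega)]
      push_cast
      rw [pow_succ]
      field_simp
    rw [dyadicFloor, dyadicFloor, ← hj, heq]
    obtain h | h : ⌊(2 : ℝ) ^ (m + 1) * t⌋₊ = 2 * j ∨ ⌊(2 : ℝ) ^ (m + 1) * t⌋₊ = 2 * j + 1 := by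
      omega
    · rw [h, dist_self]; positivity
    · rw [h, dist_comm, dist_eq_norm]
      refine (hK (m + 1) (2 * j) (by omega)).trans_eq ?_
      rw [pow_succ]; ring
  have htail : ∀ (t : I) (m : ℕ), ‖F (dyadicFloor m t) - F t‖ ≤ K * ρ / (1 - ρ) * ρ ^ m := by
    intro t m
    have := dist_le_of_le_geometric_of_tendsto ρ (K * ρ) hρ1 (hsame t)
      ((hF.tendsto t).comp (tendsto_dyadicFloor t)) m
    rw [dist_eq_norm] at this
    refine this.trans_eq ?_
    ring
  refine ⟨(2 * (K * ρ / (1 - ρ)) + K) * ρ⁻¹, fun s t hst => ?_⟩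
  have hd : 0 < (t : ℝ) - s := sub_pos.2 hst
  have hd1 : (t : ℝ) - s ≤ 1 := by have := t.2.2; have := s.2.1; linarith
  obtain ⟨m, hm1, hm2⟩ := exists_nat_pow_near_of_lt_one hd hd1 (show (0 : ℝ) < 1 / 2 by norm_num)
    (by norm_num)
  have hadj : ‖F (dyadicFloor m t) - F (dyadicFloor m s)‖ ≤ K * ρ ^ m := by
    have hs := s.2.1
    have hle : ⌊(2 : ℝ) ^ m * s⌋₊ ≤ ⌊(2 : ℝ) ^ m * t⌋₊ := Nat.floor_mono (by gcongr)
    have hle' : ⌊(2 : ℝ) ^ m * t⌋₊ ≤ ⌊(2 : ℝ) ^ m * s⌋₊ + 1 := by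
      rw [← Nat.floor_add_one (by positivity)]
      refine Nat.floor_mono ?_
      have : (2 : ℝ) ^ m * ((t : ℝ) - s) ≤ 2 ^ m * (1 / 2) ^ m := by gcongr
      rw [← mul_pow] at this
      norm_num at this
      linarith
    rw [dyadicFloor, dyadicFloor]
    obtain h | h : ⌊(2 : ℝ) ^ m * t⌋₊ = ⌊(2 : ℝ) ^ m * s⌋₊ ∨
        ⌊(2 : ℝ) ^ m * t⌋₊ = ⌊(2 : ℝ) ^ m * s⌋₊ + 1 := by omega
    · rw [h, sub_self, norm_zero]; positivity
    · rw [h]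
      refine hK m _ ?_
      have := floor_two_pow_mul_le m t
      omega
  have hpow : ρ ^ (m + 1) ≤ ((t : ℝ) - s) ^ β := by
    have h1 : ρ ^ (m + 1) = ((1 / 2 : ℝ) ^ (m + 1)) ^ β := by
      rw [hρ, ← Real.rpow_natCast, ← Real.rpow_natCast, ← Real.rpow_mul (by norm_num),
        ← Real.rpow_mul (by norm_num), one_div, Real.inv_rpow (by norm_num),
        ← Real.rpow_neg (by norm_num)]
      ring_nf
    rw [h1]
    exact Real.rpow_le_rpow (by positivity) hm1.le hβ.le
  calc ‖F t - F s‖ = ‖-(F (dyadicFloor m t) - F t) +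
        (F (dyadicFloor m t) - F (dyadicFloor m s)) + (F (dyadicFloor m s) - F s)‖ := by
        congr 1; abel
    _ ≤ ‖F (dyadicFloor m t) - F t‖ + ‖F (dyadicFloor m t) - F (dyadicFloor m s)‖ +
        ‖F (dyadicFloor m s) - F s‖ := by
        refine (norm_add₃_le).trans ?_
        rw [norm_neg]
    _ ≤ K * ρ / (1 - ρ) * ρ ^ m + K * ρ ^ m + K * ρ / (1 - ρ) * ρ ^ m := by
        gcongr
        · exact htail t m
        · exact htail s m
    _ = ((2 * (K * ρ / (1 - ρ)) + K) * ρ⁻¹) * ρ ^ (m + 1) := by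
        rw [pow_succ]; field_simp; ring
    _ ≤ _ := by
        have : 0 < 1 - ρ := by linarith
        gcongr

end Hoelder

section HaarCoefficients

variable {H : Type*} [NormedAddCommGroup H] [InnerProductSpace ℝ H] {ι : Type*}

/-- The coefficient `∫ χ_n d⟨F, e_k⟩` of a path `F`, indexed by the pair `(k, n)`. -/
noncomputable def haarCoeff (e : HilbertBasis ι ℝ H) (F : I → H) (p : ι × ℕ) : ℝ :=
  haarIntegral (fun t => ⟪F t, e p.1⟫_ℝ) p.2

theorem haarCoeff_eq_inner (e : HilbertBasis ι ℝ H) (F : I → H) (p : ι × ℕ) :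
    haarCoeff e F p = ⟪haarIntegral F p.2, e p.1⟫_ℝ := by
  unfold haarCoeff haarIntegral
  split_ifs <;> simp only [inner_sub_left, real_inner_smul_left, smul_eq_mul]

theorem haarCoeff_sub (e : HilbertBasis ι ℝ H) (F G : I → H) (p : ι × ℕ) :
    haarCoeff e (G - F) p = haarCoeff e G p - haarCoeff e F p := by
  unfold haarCoeff haarIntegral
  split_ifs <;> simp only [Pi.sub_apply, inner_sub_left, smul_eq_mul] <;> ring

theorem haarCoeff_smul (e : HilbertBasis ι ℝ H) (c : ℝ) (F : I → H) (p : ι × ℕ) :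
    haarCoeff e (fun t => c • F t) p = c * haarCoeff e F p := by
  unfold haarCoeff haarIntegral
  split_ifs <;> simp only [real_inner_smul_left, smul_eq_mul] <;> ring

theorem haarWeight_pos (α : ℝ) (n : ℕ) : 0 < haarWeight α n := by
  unfold haarWeight
  split_ifs <;> positivity

theorem smul_mem_holderZero {α : ℝ} {F : I → H} (hF : F ∈ holderZero H α) (c : ℝ) :
    (fun t => c • F t) ∈ holderZero H α := by
  refine ⟨by simp [hF.1], fun η hη => ?_⟩
  obtain ⟨r, hr, h⟩ := hF.2 (η / (|c| + 1)) (by positivity)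
  refine ⟨r, hr, fun s t hst hd => ?_⟩
  have a := h s t hst hd
  rw [← smul_sub, norm_smul, Real.norm_eq_abs, mul_div_assoc]
  calc _ ≤ |c| * (η / (|c| + 1)) := by gcongr
    _ = η * (|c| / (|c| + 1)) := by ring
    _ ≤ η * 1 := by
        gcongr
        rw [div_le_one (by positivity)]; linarith
    _ = η := mul_one _

/-- The weights are chosen so that the weighted Haar coefficients of `F` are controlled by its
modulus of `α`-Hölder continuity; for paths in `C_α^0` they tend to zero. -/
theorem exists_haarWeight_mul_norm_le {α : ℝ} {F : I → H} (hF : F ∈ holderZero H α) {η : ℝ}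
    (hη : 0 < η) : ∃ N : ℕ, ∀ n ≥ N, haarWeight α n * ‖haarIntegral F n‖ ≤ η := by
  obtain ⟨r, hr, h⟩ := hF.2 η hη
  obtain ⟨M, hM⟩ := exists_pow_lt_of_lt_one hr (show (1 / 2 : ℝ) < 1 by norm_num)
  refine ⟨2 ^ M, fun n hn => ?_⟩
  have hn0 : n ≠ 0 := by have := Nat.two_pow_pos M; omega
  have hMk : M ≤ Nat.log 2 n := by
    exact Nat.le_log_of_pow_le (by norm_num) hn
  have hl := haar_index_lt hn0
  simp only [haarWeight, haarIntegral, hn0, if_false]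
  generalize n - 2 ^ Nat.log 2 n = l at *
  generalize Nat.log 2 n = k at *
  have hl2 : 2 * l + 2 ≤ 2 ^ (k + 1) := by rw [pow_succ]; omega
  have step : ∀ j, j + 1 ≤ 2 ^ (k + 1) →
      ‖F (dyadicPoint (j + 1) (k + 1)) - F (dyadicPoint j (k + 1))‖ ≤
        η * (2 : ℝ) ^ (-((k : ℝ) + 1) * α) := by
    intro j hj
    have hd : (dyadicPoint (j + 1) (k + 1) : ℝ) - dyadicPoint j (k + 1) = 1 / 2 ^ (k + 1) := by
      rw [coe_dyadicPoint hj, coe_dyadicPoint (by omega)]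
      push_cast
      ring
    have hne : dyadicPoint (j + 1) (k + 1) ≠ dyadicPoint j (k + 1) := by
      intro he
      rw [he, sub_self] at hd
      have : (0 : ℝ) < 1 / 2 ^ (k + 1) := by positivity
      linarith
    have := h _ _ hne (by
      rw [hd, abs_of_pos (by positivity), ← one_div_pow]
      refine lt_of_le_of_lt ?_ hM
      exact pow_le_pow_of_le_one (by norm_num) (by norm_num) (by omega))
    rw [hd, div_le_iff₀ (by positivity), abs_of_pos (by positivity)] at this
    refine this.trans_eq ?_
    congr 1
    rw [one_div, ← Real.rpow_natCast, ← Real.rpow_neg (by norm_num), ← Real.rpow_mul (by norm_num)]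
    push_cast
    ring_nf
  have s1 := step (2 * l) (by omega)
  have s2 := step (2 * l + 1) (by omega)
  calc _ ≤ (2 : ℝ) ^ ((k : ℝ) * (α - 1 / 2) + α - 1) *
        (√((2 : ℝ) ^ k) * (η * (2 : ℝ) ^ (-((k : ℝ) + 1) * α)) +
          √((2 : ℝ) ^ k) * (η * (2 : ℝ) ^ (-((k : ℝ) + 1) * α))) := by
        gcongr
        refine (norm_sub_le _ _).trans ?_
        rw [norm_smul, norm_smul, Real.norm_of_nonneg (by positivity)]
        gcongr
    _ = η * ((2 : ℝ) ^ ((k : ℝ) * (α - 1 / 2) + α - 1) * (2 : ℝ) ^ ((k : ℝ) / 2) *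
          (2 : ℝ) ^ (-((k : ℝ) + 1) * α) * (2 : ℝ) ^ (1 : ℝ)) := by
        rw [Real.sqrt_eq_rpow, ← Real.rpow_natCast, ← Real.rpow_mul (by norm_num), Real.rpow_one]
        ring_nf
    _ = η := by
        rw [← Real.rpow_add (by norm_num), ← Real.rpow_add (by norm_num),
          ← Real.rpow_add (by norm_num)]
        have : (k : ℝ) * (α - 1 / 2) + α - 1 + (k : ℝ) / 2 + -((k : ℝ) + 1) * α + 1 = 0 := by ring
        rw [this, Real.rpow_zero, mul_one]

/-- Only finitely many weighted Haar coefficients of a path in `C_α^0` are not small. -/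
theorem finite_setOf_le_haarCoeff (e : HilbertBasis ι ℝ H) {α : ℝ} {F : I → H}
    (hF : F ∈ holderZero H α) {η : ℝ} (hη : 0 < η) :
    {p : ι × ℕ | η ≤ |haarWeight α p.2 * haarCoeff e F p|}.Finite := by
  obtain ⟨N, hN⟩ := exists_haarWeight_mul_norm_le hF (half_pos hη)
  have hfin : ∀ n : ℕ, {k : ι | η ≤ |haarWeight α n * haarCoeff e F (k, n)|}.Finite := by
    intro n
    have hs : Summable fun k => ⟪haarIntegral F n, e k⟫_ℝ * ⟪e k, haarIntegral F n⟫_ℝ :=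
      e.summable_inner_mul_inner _ _
    have ht := hs.tendsto_cofinite_zero
    have := (ht.eventually (gt_mem_nhds
      (show 0 < (η / haarWeight α n) ^ 2 by have := haarWeight_pos α n; positivity)))
    refine this.subset fun k hk => ?_
    simp only [mem_ofPred_eq, haarCoeff_eq_inner] at hk
    have hw := haarWeight_pos α n
    rw [abs_mul, abs_of_pos hw, mul_comm, ← div_le_iff₀ hw] at hk
    simp only [mem_compl_iff, mem_ofPred_eq, not_lt]
    rw [real_inner_comm (haarIntegral F n) (e k), ← pow_two,
      ← sq_abs ⟪haarIntegral F n, e k⟫_ℝ]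
    exact pow_le_pow_left₀ (by positivity) hk 2
  refine ((Finset.range N).finite_toSet.biUnion fun n _ =>
    ((hfin n).image fun k => (k, n))).subset fun p hp => ?_
  simp only [mem_iUnion, mem_image]
  refine ⟨p.2, ?_, p.1, hp, rfl⟩
  simp only [Finset.coe_range, mem_Iio]
  by_contra hlt
  have h1 := hN p.2 (not_lt.1 hlt)
  have h2 : |haarWeight α p.2 * haarCoeff e F p| ≤ haarWeight α p.2 * ‖haarIntegral F p.2‖ := by
    rw [abs_mul, abs_of_pos (haarWeight_pos α p.2), haarCoeff_eq_inner]
    have := haarWeight_pos α p.2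
    gcongr
    refine (abs_real_inner_le_norm _ _).trans_eq ?_
    rw [e.orthonormal.1, mul_one]
  have := hp
  simp only [mem_ofPred_eq] at this
  linarith

theorem exists_haarCoeff_le (e : HilbertBasis ι ℝ H) {α : ℝ} {F : I → H}
    (hF : F ∈ holderZero H α) :
    ∃ M : ℝ, ∀ p : ι × ℕ, haarWeight α p.2 * |haarCoeff e F p| ≤ M := by
  have hfin := finite_setOf_le_haarCoeff e hF one_pos
  obtain ⟨M, hM⟩ := (hfin.image fun p => |haarWeight α p.2 * haarCoeff e F p|).bddAbove
  refine ⟨max M 1, fun p => ?_⟩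
  rw [← abs_of_pos (haarWeight_pos α p.2), ← abs_mul]
  obtain h | h := le_total 1 |haarWeight α p.2 * haarCoeff e F p|
  · exact (hM (mem_image_of_mem _ h)).trans (le_max_left _ _)
  · exact h.trans (le_max_right _ _)

/-- On `C_α^0` the weighted coefficients tend to zero, so that a strict bound on each of them is a
strict bound on their supremum. -/
theorem coarseNorm_lt_iff (e : HilbertBasis ι ℝ H) {α : ℝ} {F : I → H} (hF : F ∈ holderZero H α)
    {δ : ℝ} (hδ : 0 < δ) :
    coarseNorm e α F < ENNReal.ofReal δ ↔
      ∀ p : ι × ℕ, |haarWeight α p.2 * haarCoeff e F p| < δ := by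
  constructor
  · intro h p
    have : ENNReal.ofReal |haarWeight α p.2 * haarCoeff e F p| ≤ coarseNorm e α F :=
      le_iSup₂ (f := fun (k : ι) (n : ℕ) => ENNReal.ofReal
        |haarWeight α n * haarIntegral (fun t => ⟪F t, e k⟫_ℝ) n|) p.1 p.2
    exact (ENNReal.ofReal_lt_ofReal_iff hδ).1 (this.trans_lt h)
  · intro h
    have hfin := finite_setOf_le_haarCoeff e hF (half_pos hδ)
    obtain ⟨m, hm, hmδ⟩ : ∃ m : ℝ, (∀ p : ι × ℕ, |haarWeight α p.2 * haarCoeff e F p| ≤ m) ∧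
        m < δ := by
      obtain hempty | hne := hfin.toFinset.eq_empty_or_nonempty
      · refine ⟨δ / 2, fun p => ?_, by linarith⟩
        by_contra hc
        have : p ∈ hfin.toFinset := hfin.mem_toFinset.2 (not_le.1 hc).le
        rw [hempty] at this
        exact Finset.notMem_empty p this
      · obtain ⟨q, hq, hmax⟩ := hfin.toFinset.exists_max_image
          (fun p => |haarWeight α p.2 * haarCoeff e F p|) hne
        refine ⟨_, fun p => ?_, h q⟩
        by_cases hp : p ∈ hfin.toFinset
        · exact hmax p hp
        · simp only [Finite.mem_toFinset, mem_ofPred_eq, not_le] at hp hq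
          linarith
    refine lt_of_le_of_lt (iSup₂_le fun k n => ?_) ((ENNReal.ofReal_lt_ofReal_iff hδ).2 hmδ)
    exact ENNReal.ofReal_le_ofReal (hm (k, n))

theorem mem_coarseBall_iff (e : HilbertBasis ι ℝ H) {α : ℝ} {F G : I → H}
    (hF : F ∈ holderZero H α) {δ : ℝ} (hδ : 0 < δ) :
    G ∈ coarseBall e α δ F ↔ G ∈ holderZero H α ∧
      ∀ p : ι × ℕ, haarWeight α p.2 * |haarCoeff e G p - haarCoeff e F p| < δ := by
  refine and_congr_right fun hG => ?_
  rw [coarseNorm_lt_iff e (sub_mem_holderZero hF hG) hδ]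
  refine forall_congr' fun p => ?_
  rw [haarCoeff_sub, abs_mul, abs_of_pos (haarWeight_pos α p.2)]

end HaarCoefficients

/-! ### The reproducing kernel norm -/

section CameronMartin

variable {H : Type*} [NormedAddCommGroup H] [InnerProductSpace ℝ H] {ι : Type*}
  (e : HilbertBasis ι ℝ H) {lam : ι → ℝ}

theorem eq_of_forall_inner_eq {x y : H} (h : ∀ k, ⟪x, e k⟫_ℝ = ⟪y, e k⟫_ℝ) : x = y := by
  apply e.repr.injective
  ext k
  rw [e.repr_apply_apply, e.repr_apply_apply, real_inner_comm, h, real_inner_comm]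

theorem hasSum_inner_sq (x : H) : HasSum (fun k => ⟪x, e k⟫_ℝ ^ 2) (‖x‖ ^ 2) := by
  have := e.hasSum_inner_mul_inner x x
  rw [real_inner_self_eq_norm_sq] at this
  simp_rw [real_inner_comm x (e _), ← pow_two] at this
  exact this

theorem inner_sqrtOperator (h0 : ∀ k, 0 ≤ lam k) {B : ℝ} (hB : ∀ k, lam k ≤ B) (x : H) (k : ι) :
    ⟪sqrtOperator e lam x, e k⟫_ℝ = √(lam k) * ⟪x, e k⟫_ℝ := by
  have hmem : Memℓp (fun k => √(lam k) * ⟪x, e k⟫_ℝ) 2 := by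
    rw [memℓp_gen_iff (by norm_num)]
    refine Summable.of_nonneg_of_le (fun k => by positivity) (fun k => ?_)
      ((hasSum_inner_sq e x).summable.mul_left B)
    simp only [ENNReal.toReal_ofNat, Real.rpow_ofNat, Real.norm_eq_abs, sq_abs, mul_pow,
      Real.sq_sqrt (h0 k)]
    gcongr
    exact hB k
  have hs := e.hasSum_repr_symm ⟨_, hmem⟩
  have : sqrtOperator e lam x = e.repr.symm ⟨_, hmem⟩ := hs.tsum_eq
  rw [this, real_inner_comm, ← e.repr_apply_apply, LinearIsometryEquiv.apply_symm_apply]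

theorem norm_sqrtOperator_le (h0 : ∀ k, 0 ≤ lam k) {B : ℝ} (hB : ∀ k, lam k ≤ B) (x : H) :
    ‖sqrtOperator e lam x‖ ≤ √B * ‖x‖ := by
  obtain hι | ⟨⟨k₀⟩⟩ := isEmpty_or_nonempty ι
  · have : sqrtOperator e lam x = 0 := eq_of_forall_inner_eq e fun k => (hι.false k).elim
    rw [this, norm_zero]; positivity
  have hB0 : 0 ≤ B := (h0 k₀).trans (hB k₀)
  have : ‖sqrtOperator e lam x‖ ^ 2 ≤ B * ‖x‖ ^ 2 := by
    refine hasSum_le (fun k => ?_) (hasSum_inner_sq e _) ((hasSum_inner_sq e x).mul_left B)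
    rw [inner_sqrtOperator e h0 hB, mul_pow, Real.sq_sqrt (h0 k)]
    gcongr
    exact hB k
  refine abs_le_of_sq_le_sq' ?_ (by positivity) |>.2
  rwa [mul_pow, Real.sq_sqrt hB0]

/-- The inclusion of `H_0` in `H` is bounded. -/
theorem enorm_le_mul_cameronMartinNorm (h0 : ∀ k, 0 ≤ lam k) {B : ℝ} (hB : ∀ k, lam k ≤ B)
    {x : H} (hx : x ∈ range (sqrtOperator e lam)) :
    ‖x‖ₑ ≤ ENNReal.ofReal √B * cameronMartinNorm e lam x := by
  have key : ∀ y, sqrtOperator e lam y = x → ‖x‖ₑ ≤ ENNReal.ofReal √B * ‖y‖ₑ := by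
    rintro y rfl
    rw [← ofReal_norm, ← ofReal_norm, ← ENNReal.ofReal_mul (by positivity)]
    exact ENNReal.ofReal_le_ofReal (norm_sqrtOperator_le e h0 hB y)
  obtain ⟨y₀, hy₀⟩ := hx
  by_cases hB0 : ENNReal.ofReal √B = 0
  · have := key y₀ hy₀
    rw [hB0, zero_mul] at this
    exact this.trans zero_le
  · unfold cameronMartinNorm
    simp_rw [ENNReal.mul_iInf_of_ne hB0 ENNReal.ofReal_ne_top]
    exact le_iInf₂ key

/-- The norm of `H_0` dominates its partial expression in the eigenbasis; the terms with `λ_k = 0`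
vanish by the convention `x / 0 = 0`. -/
theorem ofReal_sum_inner_sq_div_le (h0 : ∀ k, 0 ≤ lam k) {B : ℝ} (hB : ∀ k, lam k ≤ B) (x : H)
    (K : Finset ι) :
    ENNReal.ofReal (∑ k ∈ K, ⟪x, e k⟫_ℝ ^ 2 / lam k) ≤ cameronMartinNorm e lam x ^ 2 := by
  have hA : 0 ≤ ∑ k ∈ K, ⟪x, e k⟫_ℝ ^ 2 / lam k :=
    Finset.sum_nonneg fun k _ => div_nonneg (sq_nonneg _) (h0 k)
  rw [← Real.sq_sqrt hA, ENNReal.ofReal_pow (Real.sqrt_nonneg _)]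
  gcongr
  refine le_iInf₂ fun y hy => ?_
  rw [← ofReal_norm]
  refine ENNReal.ofReal_le_ofReal (Real.sqrt_le_iff.2 ⟨norm_nonneg _, ?_⟩)
  refine le_trans (Finset.sum_le_sum fun k _ => ?_)
    (sum_le_hasSum K (fun k _ => sq_nonneg _) (hasSum_inner_sq e y))
  rw [← hy, inner_sqrtOperator e h0 hB, mul_pow, Real.sq_sqrt (h0 k)]
  obtain h | h := (h0 k).eq_or_lt
  · rw [← h, div_zero]; positivity
  · rw [mul_div_cancel_left₀ _ h.ne']

theorem inner_eq_zero_of_mem_range (h0 : ∀ k, 0 ≤ lam k) {B : ℝ} (hB : ∀ k, lam k ≤ B) {x : H}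
    (hx : x ∈ range (sqrtOperator e lam)) {k : ι} (hk : lam k = 0) : ⟪x, e k⟫_ℝ = 0 := by
  obtain ⟨y, rfl⟩ := hx
  rw [inner_sqrtOperator e h0 hB, hk, Real.sqrt_zero, zero_mul]

end CameronMartin

/-! ### The rate function -/

/-- Bessel's inequality for the Haar system. -/
theorem sum_integral_haarFun_mul_sq_le {u : ℝ → ℝ} (hu : IntervalIntegrable u volume 0 1)
    (hu2 : IntervalIntegrable (fun s => u s ^ 2) volume 0 1) (N : Finset ℕ) :
    ∑ n ∈ N, (∫ s in (0 : ℝ)..1, haarFun n s * u s) ^ 2 ≤ ∫ s in (0 : ℝ)..1, u s ^ 2 := by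
  set a : ℕ → ℝ := fun n => ∫ s in (0 : ℝ)..1, haarFun n s * u s with ha
  have hi1 : ∀ n, IntervalIntegrable (fun s => haarFun n s * u s) volume 0 1 :=
    intervalIntegrable_haarFun_mul hu
  have hi2 : ∀ m n, IntervalIntegrable (fun s => haarFun m s * haarFun n s) volume 0 1 :=
    fun m n => intervalIntegrable_haarFun_mul (intervalIntegrable_haarFun n 0 1) m
  have hpos : 0 ≤ ∫ s in (0 : ℝ)..1, (u s - ∑ n ∈ N, a n * haarFun n s) ^ 2 :=
    intervalIntegral.integral_nonneg zero_le_one fun s _ => sq_nonneg _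
  have hexp : ∀ s, (u s - ∑ n ∈ N, a n * haarFun n s) ^ 2 =
      u s ^ 2 - 2 * (∑ n ∈ N, a n * (haarFun n s * u s)) +
        ∑ m ∈ N, ∑ n ∈ N, a m * a n * (haarFun m s * haarFun n s) := by
    intro s
    have h1 : ∑ m ∈ N, ∑ n ∈ N, a m * a n * (haarFun m s * haarFun n s) =
        (∑ n ∈ N, a n * haarFun n s) * (∑ n ∈ N, a n * haarFun n s) := by
      rw [Finset.sum_mul_sum]
      exact Finset.sum_congr rfl fun m _ => Finset.sum_congr rfl fun n _ => by ring
    have h2 : ∑ n ∈ N, a n * (haarFun n s * u s) = (∑ n ∈ N, a n * haarFun n s) * u s := by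
      rw [Finset.sum_mul]
      exact Finset.sum_congr rfl fun n _ => by ring
    rw [h1, h2]; ring
  have hs1 : IntervalIntegrable (fun s => ∑ n ∈ N, a n * (haarFun n s * u s)) volume 0 1 := by
    have := IntervalIntegrable.sum N (f := fun n s => a n * (haarFun n s * u s))
      (fun n _ => (hi1 n).const_mul (a n))
    rwa [Finset.sum_fn] at this
  have hs2 : ∀ m, IntervalIntegrable
      (fun s => ∑ n ∈ N, a m * a n * (haarFun m s * haarFun n s)) volume 0 1 := by
    intro m
    have := IntervalIntegrable.sum N (f := fun n s => a m * a n * (haarFun m s * haarFun n s))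
      (fun n _ => (hi2 m n).const_mul (a m * a n))
    rwa [Finset.sum_fn] at this
  have hs3 : IntervalIntegrable
      (fun s => ∑ m ∈ N, ∑ n ∈ N, a m * a n * (haarFun m s * haarFun n s)) volume 0 1 := by
    have := IntervalIntegrable.sum N
      (f := fun m s => ∑ n ∈ N, a m * a n * (haarFun m s * haarFun n s)) (fun m _ => hs2 m)
    rwa [Finset.sum_fn] at this
  simp_rw [hexp] at hpos
  rw [intervalIntegral.integral_add (hu2.sub (hs1.const_mul 2)) hs3,
    intervalIntegral.integral_sub hu2 (hs1.const_mul 2), intervalIntegral.integral_const_mul,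
    intervalIntegral.integral_finsetSum fun n _ => (hi1 n).const_mul (a n),
    intervalIntegral.integral_finsetSum fun m _ => hs2 m] at hpos
  have h1 : ∑ m ∈ N, ∫ s in (0 : ℝ)..1, ∑ n ∈ N, a m * a n * (haarFun m s * haarFun n s) =
      ∑ m ∈ N, a m ^ 2 := by
    refine Finset.sum_congr rfl fun m hm => ?_
    rw [intervalIntegral.integral_finsetSum fun n _ => (hi2 m n).const_mul _]
    simp_rw [intervalIntegral.integral_const_mul, integral_haarFun_mul_haarFun]
    simp [hm, pow_two]
  have h2 : ∑ n ∈ N, ∫ s in (0 : ℝ)..1, a n * (haarFun n s * u s) = ∑ n ∈ N, a n ^ 2 := by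
    refine Finset.sum_congr rfl fun n _ => ?_
    rw [intervalIntegral.integral_const_mul, pow_two]
  rw [h1, h2] at hpos
  linarith

section Primitive

variable {H : Type*} [NormedAddCommGroup H] [InnerProductSpace ℝ H] [CompleteSpace H] {ι : Type*}

/-- The Haar coefficients of a primitive are the Haar coefficients of its derivative. -/
theorem haarCoeff_primitive (e : HilbertBasis ι ℝ H) {U : ℝ → H}
    (hU : IntervalIntegrable U volume 0 1) {G : I → H}
    (hG : ∀ t : I, G t = ∫ s in (0 : ℝ)..(t : ℝ), U s) (p : ι × ℕ) :
    haarCoeff e G p = ∫ s in (0 : ℝ)..1, haarFun p.2 s * ⟪U s, e p.1⟫_ℝ := by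
  have hi : IntervalIntegrable (fun s => ⟪U s, e p.1⟫_ℝ) volume 0 1 := by
    rw [intervalIntegrable_iff] at hU ⊢
    exact hU.inner_const (𝕜 := ℝ) (e p.1)
  rw [← haarIntegral_primitive hi, haarCoeff]
  congr 1
  ext t
  have ht : IntervalIntegrable U volume 0 (t : ℝ) := hU.mono_set (by
    rw [uIcc_of_le t.2.1, uIcc_of_le zero_le_one]
    exact Icc_subset_Icc le_rfl t.2.2)
  rw [hG, real_inner_comm, ← innerSL_apply_apply ℝ,
    ← ContinuousLinearMap.intervalIntegral_comp_comm _ ht]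
  simp only [innerSL_apply_apply, real_inner_comm]

end Primitive

section Rate

variable {H : Type*} [NormedAddCommGroup H] [InnerProductSpace ℝ H]
  [TopologicalSpace.SeparableSpace H] [MeasurableSpace H] [BorelSpace H] {ι : Type*}
  (e : HilbertBasis ι ℝ H) {lam : ι → ℝ}

theorem MemL2CameronMartin.memLp_two (h0 : ∀ k, 0 ≤ lam k) {B : ℝ} (hB : ∀ k, lam k ≤ B)
    {U : ℝ → H} (hU : MemL2CameronMartin e lam U) :
    MemLp U 2 (volume.restrict (Icc (0 : ℝ) 1)) := by
  have : SecondCountableTopology H := UniformSpace.secondCountable_of_separable H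
  refine ⟨hU.1.stronglyMeasurable.aestronglyMeasurable, ?_⟩
  rw [eLpNorm_lt_top_iff_lintegral_rpow_enorm_lt_top (by norm_num) (by norm_num)]
  calc _ ≤ ∫⁻ s in Icc (0 : ℝ) 1,
        ENNReal.ofReal √B ^ 2 * cameronMartinNorm e lam (U s) ^ 2 := by
        refine setLIntegral_mono' measurableSet_Icc fun s hs => ?_
        simp only [ENNReal.toReal_ofNat, ENNReal.rpow_ofNat]
        rw [← mul_pow]
        gcongr
        exact enorm_le_mul_cameronMartinNorm e h0 hB (hU.2.1 s hs)
    _ = ENNReal.ofReal √B ^ 2 * ∫⁻ s in Icc (0 : ℝ) 1, cameronMartinNorm e lam (U s) ^ 2 :=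
        lintegral_const_mul' _ _ (by simp)
    _ < ∞ := ENNReal.mul_lt_top (by simp) hU.2.2

variable [CompleteSpace H]

/-- A path of finite energy has no Haar coefficients in the kernel of `Q`. -/
theorem rateFunction_eq_top (h0 : ∀ k, 0 ≤ lam k) {B : ℝ} (hB : ∀ k, lam k ≤ B) {G : I → H}
    {p : ι × ℕ} (hp : lam p.1 = 0) (hG : haarCoeff e G p ≠ 0) : rateFunction e lam G = ⊤ := by
  refine iInf_eq_top.2 fun U => iInf_eq_top.2 fun hU => iInf_eq_top.2 fun hUG => ?_
  refine absurd ?_ hG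
  have hint : IntervalIntegrable U volume 0 1 := by
    rw [intervalIntegrable_iff_integrableOn_Icc_of_le zero_le_one]
    exact (hU.memLp_two e h0 hB).integrable (by norm_num)
  rw [haarCoeff_primitive e hint hUG]
  rw [intervalIntegral.integral_congr (g := fun _ => 0)]
  · simp
  · intro s hs
    rw [uIcc_of_le zero_le_one] at hs
    simp [inner_eq_zero_of_mem_range e h0 hB (hU.2.1 s hs) hp]

/-- The energy of a path dominates the energy carried by finitely many of its Haar
coefficients. -/
theorem ofReal_sum_haarCoeff_sq_le_rateFunction (h0 : ∀ k, 0 ≤ lam k) {B : ℝ}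
    (hB : ∀ k, lam k ≤ B) (G : I → H) (S : Finset (ι × ℕ)) :
    ENNReal.ofReal (∑ p ∈ S, haarCoeff e G p ^ 2 / (2 * lam p.1)) ≤ rateFunction e lam G := by
  classical
  refine le_iInf fun U => le_iInf fun hU => le_iInf fun hUG => ?_
  have hL2 := hU.memLp_two e h0 hB
  have hint : IntervalIntegrable U volume 0 1 := by
    rw [intervalIntegrable_iff_integrableOn_Icc_of_le zero_le_one]
    exact hL2.integrable (by norm_num)
  have hk2 : ∀ k, Integrable (fun s => ⟪U s, e k⟫_ℝ ^ 2) (volume.restrict (Icc (0 : ℝ) 1)) :=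
    fun k => (hL2.inner_const (𝕜 := ℝ) (e k)).integrable_sq
  have hk1 : ∀ k, IntervalIntegrable (fun s => ⟪U s, e k⟫_ℝ) volume 0 1 := fun k => by
    rw [intervalIntegrable_iff_integrableOn_Icc_of_le zero_le_one]
    exact (hL2.inner_const (𝕜 := ℝ) (e k)).integrable (by norm_num)
  have hbessel : ∀ k, ∑ n ∈ S.image Prod.snd, haarCoeff e G (k, n) ^ 2 ≤
      ∫ s in Icc (0 : ℝ) 1, ⟪U s, e k⟫_ℝ ^ 2 := by
    intro k
    rw [integral_Icc_eq_integral_Ioc, ← intervalIntegral.integral_of_le zero_le_one]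
    simp_rw [haarCoeff_primitive e hint hUG]
    refine sum_integral_haarFun_mul_sq_le (hk1 k) ?_ _
    rw [intervalIntegrable_iff_integrableOn_Icc_of_le zero_le_one]
    exact hk2 k
  have hhalf : (1 / 2 : ℝ≥0∞) = ENNReal.ofReal (1 / 2) := by
    rw [ENNReal.ofReal_div_of_pos (by norm_num)]; simp
  calc _ ≤ ENNReal.ofReal (1 / 2 * ∑ k ∈ S.image Prod.fst,
          (∫ s in Icc (0 : ℝ) 1, ⟪U s, e k⟫_ℝ ^ 2) / lam k) := by
        refine ENNReal.ofReal_le_ofReal ?_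
        calc _ ≤ ∑ p ∈ S.image Prod.fst ×ˢ S.image Prod.snd,
              haarCoeff e G p ^ 2 / (2 * lam p.1) := by
              refine Finset.sum_le_sum_of_subset_of_nonneg Finset.subset_product fun p _ _ => ?_
              have := h0 p.1
              positivity
          _ = 1 / 2 * ∑ k ∈ S.image Prod.fst,
              (∑ n ∈ S.image Prod.snd, haarCoeff e G (k, n) ^ 2) / lam k := by
              rw [Finset.sum_product, Finset.mul_sum]
              refine Finset.sum_congr rfl fun k _ => ?_
              rw [Finset.sum_div, Finset.mul_sum]
              refine Finset.sum_congr rfl fun n _ => ?_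
              rw [mul_comm (2 : ℝ), ← div_div]; ring
          _ ≤ _ := by
              gcongr with k _
              · exact h0 k
              · exact hbessel k
    _ = 1 / 2 * ∫⁻ s in Icc (0 : ℝ) 1,
          ENNReal.ofReal (∑ k ∈ S.image Prod.fst, ⟪U s, e k⟫_ℝ ^ 2 / lam k) := by
        rw [ENNReal.ofReal_mul (by norm_num), hhalf, ← ofReal_integral_eq_lintegral_ofReal
          (integrable_finsetSum _ fun k _ => (hk2 k).div_const _)
          (ae_of_all _ fun s => Finset.sum_nonneg fun k _ => div_nonneg (sq_nonneg _) (h0 k)),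
          integral_finsetSum _ fun k _ => (hk2 k).div_const _]
        simp_rw [integral_div]
    _ ≤ _ := by
        gcongr with s
        exact ofReal_sum_inner_sq_div_le e h0 hB _ _

/-- Finitely many Haar coefficients outside the kernel of `Q` can be prescribed, at the expected
cost, by a path in `C_α^0` whose other Haar coefficients vanish. -/
theorem exists_path_haarCoeff_eq (h0 : ∀ k, 0 ≤ lam k) {B : ℝ} (hB : ∀ k, lam k ≤ B) {α : ℝ}
    (hα : α < 1) (S : Finset (ι × ℕ)) (a : ι × ℕ → ℝ) (ha : ∀ p, lam p.1 = 0 → a p = 0) :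
    ∃ G ∈ holderZero H α, (∀ p, p ∈ S → haarCoeff e G p = a p) ∧
      (∀ p, p ∉ S → haarCoeff e G p = 0) ∧
      rateFunction e lam G ≤ ENNReal.ofReal (∑ p ∈ S, a p ^ 2 / (2 * lam p.1)) := by
  classical
  have : SecondCountableTopology H := UniformSpace.secondCountable_of_separable H
  set U : ℝ → H := fun s => ∑ p ∈ S, (a p * haarFun p.2 s) • e p.1 with hUdef
  -- `Y` is the preimage of `U` under `Q^{1/2}`
  set Y : ℝ → H := fun s => ∑ p ∈ S, (a p / √(lam p.1) * haarFun p.2 s) • e p.1 with hYdef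
  have hort : ∀ k l, ⟪e k, e l⟫_ℝ = if k = l then 1 else 0 := fun k l =>
    orthonormal_iff_ite.1 e.orthonormal k l
  have hUY : ∀ s, sqrtOperator e lam (Y s) = U s := by
    intro s
    refine eq_of_forall_inner_eq e fun k => ?_
    rw [inner_sqrtOperator e h0 hB]
    simp only [hUdef, hYdef, sum_inner, real_inner_smul_left, hort, Finset.mul_sum]
    refine Finset.sum_congr rfl fun p _ => ?_
    by_cases hpk : p.1 = k
    · rw [← hpk, if_pos rfl]
      obtain h | h := (h0 p.1).eq_or_lt
      · rw [ha p h.symm]; simp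
      · have : √(lam p.1) ≠ 0 := (Real.sqrt_pos.2 h).ne'
        field_simp
    · simp [hpk]
  have hUmeas : Measurable U := by
    refine Finset.measurable_fun_sum S fun p _ => ?_
    exact ((measurable_haarFun p.2).const_mul (a p)).smul_const _
  have hcm : ∀ s, cameronMartinNorm e lam (U s) ≤ ‖Y s‖ₑ := fun s => iInf₂_le (Y s) (hUY s)
  have hY2 : ∀ s, ‖Y s‖ ^ 2 = ∑ p ∈ S, ∑ q ∈ S, (a p / √(lam p.1)) * (a q / √(lam q.1)) *
      (if p.1 = q.1 then 1 else 0) * (haarFun p.2 s * haarFun q.2 s) := by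
    intro s
    rw [← real_inner_self_eq_norm_sq]
    simp only [hYdef, sum_inner, inner_sum, real_inner_smul_left, real_inner_smul_right, hort]
    exact Finset.sum_congr rfl fun p _ => Finset.sum_congr rfl fun q _ => by
      rw [eq_comm (a := q.1)]; ring
  have hi2 : ∀ m n (c : ℝ), IntegrableOn (fun s => c * (haarFun m s * haarFun n s)) (Icc 0 1) :=
    fun m n c => (intervalIntegrable_iff_integrableOn_Icc_of_le zero_le_one).1
      ((intervalIntegrable_haarFun_mul (intervalIntegrable_haarFun n 0 1) m).const_mul c)
  have hY2int : IntegrableOn (fun s => ‖Y s‖ ^ 2) (Icc 0 1) := by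
    simp_rw [hY2]
    exact integrable_finsetSum _ fun p _ => integrable_finsetSum _ fun q _ => hi2 _ _ _
  have hYval : ∫ s in Icc (0 : ℝ) 1, ‖Y s‖ ^ 2 = ∑ p ∈ S, a p ^ 2 / lam p.1 := by
    simp_rw [hY2]
    rw [integral_finsetSum _ fun p _ => integrable_finsetSum _ fun q _ => hi2 _ _ _]
    refine Finset.sum_congr rfl fun p hp => ?_
    rw [integral_finsetSum _ fun q _ => hi2 _ _ _]
    have : ∀ q, ∫ s in Icc (0 : ℝ) 1, (a p / √(lam p.1)) * (a q / √(lam q.1)) *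
        (if p.1 = q.1 then 1 else 0) * (haarFun p.2 s * haarFun q.2 s) =
        if p = q then a p ^ 2 / lam p.1 else 0 := by
      intro q
      rw [integral_const_mul, integral_Icc_eq_integral_Ioc,
        ← intervalIntegral.integral_of_le zero_le_one, integral_haarFun_mul_haarFun]
      by_cases hpq : p = q
      · subst hpq
        simp only [if_true, mul_one]
        rw [div_mul_div_comm, Real.mul_self_sqrt (h0 _), pow_two]
      · rw [if_neg hpq]
        by_cases h1 : p.1 = q.1
        · have h2 : p.2 ≠ q.2 := fun h2 => hpq (Prod.ext h1 h2)
          simp [h2]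
        · simp [h1]
    simp_rw [this]
    simp [hp]
  have hYlint : ∫⁻ s in Icc (0 : ℝ) 1, ‖Y s‖ₑ ^ 2 =
      ENNReal.ofReal (∑ p ∈ S, a p ^ 2 / lam p.1) := by
    rw [← hYval, ofReal_integral_eq_lintegral_ofReal hY2int (ae_of_all _ fun s => sq_nonneg _)]
    refine lintegral_congr fun s => ?_
    rw [ENNReal.ofReal_pow (norm_nonneg _), ofReal_norm]
  have hle : ∫⁻ s in Icc (0 : ℝ) 1, cameronMartinNorm e lam (U s) ^ 2 ≤
      ENNReal.ofReal (∑ p ∈ S, a p ^ 2 / lam p.1) := by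
    rw [← hYlint]
    gcongr with s
    exact hcm s
  have hU : MemL2CameronMartin e lam U :=
    ⟨hUmeas, fun s _ => ⟨Y s, hUY s⟩, hle.trans_lt ENNReal.ofReal_lt_top⟩
  have hint : ∀ x y, IntervalIntegrable U volume x y := fun x y => by
    have := IntervalIntegrable.sum S (f := fun p s => (a p * haarFun p.2 s) • e p.1)
      (μ := volume) (a := x) (b := y) (fun p _ => by
        have := (intervalIntegrable_haarFun p.2 x y).const_mul (a p)
        rw [intervalIntegrable_iff] at this ⊢
        exact this.smul_const _)
    rwa [Finset.sum_fn] at this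
  set G : I → H := fun t => ∫ s in (0 : ℝ)..(t : ℝ), U s with hGdef
  have hcoeff : ∀ p, haarCoeff e G p = ∑ q ∈ S, if p = q then a q else 0 := by
    intro p
    rw [haarCoeff_primitive e (hint 0 1) (fun t => rfl)]
    simp only [hUdef, sum_inner, real_inner_smul_left, hort, Finset.mul_sum]
    have : ∀ q s, haarFun p.2 s * (a q * haarFun q.2 s * if q.1 = p.1 then 1 else 0) =
        (a q * if q.1 = p.1 then 1 else 0) * (haarFun p.2 s * haarFun q.2 s) := fun q s => by ring
    simp_rw [this]
    rw [intervalIntegral.integral_finsetSum fun q _ =>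
      (intervalIntegrable_haarFun_mul (intervalIntegrable_haarFun q.2 0 1) p.2).const_mul _]
    refine Finset.sum_congr rfl fun q _ => ?_
    rw [intervalIntegral.integral_const_mul, integral_haarFun_mul_haarFun]
    by_cases hpq : p = q
    · subst hpq; simp
    · rw [if_neg hpq]
      by_cases h1 : q.1 = p.1
      · have h2 : p.2 ≠ q.2 := fun h2 => hpq (Prod.ext h1.symm h2)
        simp [h2]
      · simp [h1]
  refine ⟨G, ?_, fun p hp => ?_, fun p hp => ?_, ?_⟩
  · refine mem_holderZero_of_holder (β := 1)
      (C := ∑ p ∈ S, |a p| * √((2 : ℝ) ^ Nat.log 2 p.2)) hα (by simp [hGdef]) fun s t hst => ?_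
    rw [Real.rpow_one, hGdef]
    dsimp only
    rw [intervalIntegral.integral_interval_sub_left (hint _ _) (hint _ _)]
    have := intervalIntegral.norm_integral_le_of_norm_le_const (a := (s : ℝ)) (b := t) (f := U)
      (C := ∑ p ∈ S, |a p| * √((2 : ℝ) ^ Nat.log 2 p.2)) (fun x _ => by
        refine (norm_sum_le _ _).trans (Finset.sum_le_sum fun p _ => ?_)
        rw [norm_smul, e.orthonormal.1, mul_one, Real.norm_eq_abs, abs_mul]
        gcongr
        exact abs_haarFun_le _ _)
    rwa [abs_of_pos (sub_pos.2 (show (s : ℝ) < t from hst))] at this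
  · rw [hcoeff]; simp [hp]
  · rw [hcoeff]; simp [hp]
  · refine (iInf_le_of_le U (iInf₂_le_of_le hU (fun t => rfl) le_rfl)).trans ?_
    have hhalf : (1 / 2 : ℝ≥0∞) = ENNReal.ofReal (1 / 2) := by
      rw [ENNReal.ofReal_div_of_pos (by norm_num)]; simp
    calc _ ≤ (1 / 2 : ℝ≥0∞) * ENNReal.ofReal (∑ p ∈ S, a p ^ 2 / lam p.1) := by gcongr
      _ = _ := by
        rw [hhalf, ← ENNReal.ofReal_mul (by norm_num), Finset.mul_sum]
        congr 1
        refine Finset.sum_congr rfl fun p _ => ?_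
        rw [mul_comm (2 : ℝ), ← div_div]; ring

end Rate

/-! ### Gaussian increments -/

theorem HasGaussianLawWith.charFun_map {H : Type*} [NormedAddCommGroup H] [InnerProductSpace ℝ H]
    [SecondCountableTopology H] [MeasurableSpace H] [BorelSpace H] {Ω : Type*} [MeasurableSpace Ω]
    {P : Measure Ω} {X : Ω → H} {Q : H →L[ℝ] H}
    (hX : HasGaussianLawWith X 0 Q P) (h : H) :
    charFun (P.map X) h = Complex.exp (-(1 / 2 : ℂ) * (⟪Q h, h⟫_ℝ : ℂ)) := by
  have h1 := hX.2 h
  rw [charFun_apply, integral_map hX.1 (by fun_prop)]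
  rw [inner_zero_right] at h1
  simp only [Complex.ofReal_zero, mul_zero, zero_sub] at h1
  rw [neg_mul, ← h1]
  refine integral_congr_ae (ae_of_all _ fun ω => ?_)
  simp only [real_inner_comm, mul_comm]

section GaussianLaw

variable {H : Type*} [NormedAddCommGroup H] [InnerProductSpace ℝ H]
  [SecondCountableTopology H] [MeasurableSpace H] [BorelSpace H]
  {Ω : Type*} [MeasurableSpace Ω] {P : Measure Ω} [IsProbabilityMeasure P]

theorem HasGaussianLawWith.map_inner {X : Ω → H} {Q : H →L[ℝ] H}
    (hX : HasGaussianLawWith X 0 Q P) (hQ : ∀ h, 0 ≤ ⟪Q h, h⟫_ℝ) (h : H) :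
    P.map (fun ω => ⟪X ω, h⟫_ℝ) = gaussianReal 0 (Real.toNNReal ⟪Q h, h⟫_ℝ) := by
  have hXm := hX.1
  have : IsProbabilityMeasure (P.map fun ω => ⟪X ω, h⟫_ℝ) :=
    Measure.isProbabilityMeasure_map (by fun_prop)
  refine Measure.ext_of_charFun ?_
  ext t
  have h1 := hX.charFun_map (t • h)
  rw [charFun_apply, integral_map hXm (by fun_prop)] at h1
  rw [charFun_gaussianReal, charFun_apply_real, integral_map (by fun_prop) (by fun_prop)]
  simp only [real_inner_smul_right, map_smul, real_inner_smul_left, Complex.ofReal_mul] at h1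
  rw [h1]
  congr 1
  rw [Real.coe_toNNReal _ (hQ h)]
  simp only [Complex.ofReal_zero]
  ring

theorem HasGaussianLawWith.integral_inner {X : Ω → H} {Q : H →L[ℝ] H}
    (hX : HasGaussianLawWith X 0 Q P) (hQ : ∀ h, 0 ≤ ⟪Q h, h⟫_ℝ) (h : H) :
    ∫ ω, ⟪X ω, h⟫_ℝ ∂P = 0 := by
  have hXm := hX.1
  have := integral_map (μ := P) (φ := fun ω => ⟪X ω, h⟫_ℝ) (f := fun x : ℝ => x) (by fun_prop)
    (by fun_prop)
  rw [← this, hX.map_inner hQ, integral_id_gaussianReal]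

theorem HasGaussianLawWith.variance_inner {X : Ω → H} {Q : H →L[ℝ] H}
    (hX : HasGaussianLawWith X 0 Q P) (hQ : ∀ h, 0 ≤ ⟪Q h, h⟫_ℝ) (h : H) :
    Var[fun ω => ⟪X ω, h⟫_ℝ; P] = ⟪Q h, h⟫_ℝ := by
  have hXm := hX.1
  rw [← variance_id_map (by fun_prop), hX.map_inner hQ, variance_id_gaussianReal,
    Real.coe_toNNReal _ (hQ h)]

variable [CompleteSpace H]

theorem HasGaussianLawWith.hasGaussianLaw {X : Ω → H} {Q : H →L[ℝ] H}
    (hX : HasGaussianLawWith X 0 Q P) (hQ : ∀ h, 0 ≤ ⟪Q h, h⟫_ℝ) : HasGaussianLaw X P := by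
  refine ⟨isGaussian_of_map_eq_gaussianReal fun L => ⟨0,
    Real.toNNReal ⟪Q ((InnerProductSpace.toDual ℝ H).symm L),
      (InnerProductSpace.toDual ℝ H).symm L⟫_ℝ, ?_⟩⟩
  rw [← hX.map_inner hQ ((InnerProductSpace.toDual ℝ H).symm L),
    AEMeasurable.map_map_of_aemeasurable (by fun_prop) hX.1]
  congr 1
  ext ω
  rw [real_inner_comm, InnerProductSpace.toDual_symm_apply, Function.comp_apply]

/-- A centered Gaussian law with covariance `c Q` is that with covariance `Q` scaled by `√c`. -/
theorem HasGaussianLawWith.map_eq_map_smul {X Y : Ω → H} {Q : H →L[ℝ] H} {c : ℝ} (hc : 0 ≤ c)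
    (hX : HasGaussianLawWith X 0 Q P) (hY : HasGaussianLawWith Y 0 (c • Q) P) :
    P.map Y = (P.map X).map (fun x => √c • x) := by
  have : IsProbabilityMeasure (P.map X) := Measure.isProbabilityMeasure_map hX.1
  have : IsProbabilityMeasure (P.map Y) := Measure.isProbabilityMeasure_map hY.1
  have : IsProbabilityMeasure ((P.map X).map (fun x => √c • x)) :=
    Measure.isProbabilityMeasure_map (by fun_prop)
  refine Measure.ext_of_charFun ?_
  ext h
  rw [hY.charFun_map, charFun_apply, integral_map (by fun_prop) (by fun_prop)]
  have h1 := hX.charFun_map (√c • h)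
  rw [charFun_apply] at h1
  simp only [real_inner_smul_right] at h1
  simp only [real_inner_smul_left]
  rw [h1]
  congr 3
  rw [map_smul, real_inner_smul_left, smul_apply, real_inner_smul_left,
    ← mul_assoc, Real.mul_self_sqrt hc]

end GaussianLaw

/-! ### Moments of Haar integrals of random paths -/

/-- The path `t ↦ min s t * d` is the primitive of `d` times the indicator of `[0, s]`. -/
theorem haarIntegral_min_mul (s : I) (d : ℝ) (n : ℕ) :
    haarIntegral (fun t : I => min (s : ℝ) t * d) n = ∫ r in (0 : ℝ)..(s : ℝ), haarFun n r * d := by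
  have hind : ∀ (g : ℝ → ℝ) (t : I),
      ∫ r in (0 : ℝ)..(t : ℝ), indicator {x | x ≤ (s : ℝ)} g r =
        ∫ r in (0 : ℝ)..min (s : ℝ) t, g r := by
    intro g t
    obtain h | h := le_total (s : ℝ) t
    · rw [min_eq_left h, intervalIntegral.integral_indicator ⟨s.2.1, h⟩]
    · rw [min_eq_right h]
      refine intervalIntegral.integral_congr fun r hr => ?_
      rw [uIcc_of_le t.2.1] at hr
      exact indicator_of_mem (show r ∈ {x | x ≤ (s : ℝ)} from hr.2.trans h) g
  have hint : IntervalIntegrable (indicator {x | x ≤ (s : ℝ)} fun _ => d) volume 0 1 := by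
    rw [intervalIntegrable_iff]
    exact (integrableOn_const (by simp)).indicator measurableSet_Iic
  have h1 := haarIntegral_primitive hint n
  simp_rw [hind (fun _ => d)] at h1
  simp only [intervalIntegral.integral_const, sub_zero, smul_eq_mul] at h1
  rw [h1]
  have h2 : ∀ r, haarFun n r * indicator {x | x ≤ (s : ℝ)} (fun _ => d) r =
      indicator {x | x ≤ (s : ℝ)} (fun r => haarFun n r * d) r := by
    intro r
    by_cases hr : r ≤ (s : ℝ)
    · rw [indicator_of_mem (show r ∈ {x | x ≤ (s : ℝ)} from hr),
        indicator_of_mem (show r ∈ {x | x ≤ (s : ℝ)} from hr)]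
    · rw [indicator_of_notMem (show r ∉ {x | x ≤ (s : ℝ)} from hr),
        indicator_of_notMem (show r ∉ {x | x ≤ (s : ℝ)} from hr), mul_zero]
  simp_rw [h2]
  have := hind (fun r => haarFun n r * d) 1
  rw [Icc.coe_one, min_eq_left s.2.2] at this
  exact this

/-- The Haar functions are orthonormal with respect to the covariance kernel `min s t` of
Brownian motion. -/
theorem haarIntegral_haarIntegral_min (m n : ℕ) (d : ℝ) :
    haarIntegral (fun s : I => haarIntegral (fun t : I => min (s : ℝ) t * d) n) m =
      if m = n then d else 0 := by
  simp_rw [haarIntegral_min_mul]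
  rw [haarIntegral_primitive ((intervalIntegrable_haarFun n 0 1).mul_const d)]
  simp_rw [← mul_assoc]
  rw [intervalIntegral.integral_mul_const, integral_haarFun_mul_haarFun]
  simp

section Moments

variable {Ω : Type*} [MeasurableSpace Ω] {P : Measure Ω}

theorem memLp_haarIntegral {X : I → Ω → ℝ} (hX : ∀ t, MemLp (X t) 2 P) (n : ℕ) :
    MemLp (fun ω => haarIntegral (fun t => X t ω) n) 2 P := by
  unfold haarIntegral
  split_ifs
  · exact (hX _).sub (hX _)
  · exact (((hX _).sub (hX _)).const_mul _).sub (((hX _).sub (hX _)).const_mul _)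

theorem integral_haarIntegral {X : I → Ω → ℝ} (hX : ∀ t, Integrable (X t) P) (n : ℕ) :
    ∫ ω, haarIntegral (fun t => X t ω) n ∂P = haarIntegral (fun t => ∫ ω, X t ω ∂P) n := by
  unfold haarIntegral
  split_ifs
  · exact integral_sub (hX _) (hX _)
  · simp only [smul_eq_mul]
    refine (integral_sub (((hX _).sub (hX _)).const_mul _)
      (((hX _).sub (hX _)).const_mul _)).trans (congr_arg₂ (· - ·) ?_ ?_) <;>
    exact (integral_const_mul _ _).trans (congr_arg _ (integral_sub (hX _) (hX _)))

theorem covariance_haarIntegral_left [IsFiniteMeasure P] {X : I → Ω → ℝ}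
    (hX : ∀ t, MemLp (X t) 2 P) {Z : Ω → ℝ}
    (hZ : MemLp Z 2 P) (n : ℕ) :
    cov[fun ω => haarIntegral (fun t => X t ω) n, Z; P] =
      haarIntegral (fun t => cov[X t, Z; P]) n := by
  unfold haarIntegral
  split_ifs
  · exact covariance_fun_sub_left (hX _) (hX _) hZ
  · simp only [smul_eq_mul]
    refine (covariance_fun_sub_left (((hX _).sub (hX _)).const_mul _)
      (((hX _).sub (hX _)).const_mul _) hZ).trans (congr_arg₂ (· - ·) ?_ ?_) <;>
    exact (covariance_const_mul_left _).trans
      (congr_arg _ (covariance_fun_sub_left (hX _) (hX _) hZ))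

theorem covariance_haarIntegral_haarIntegral [IsFiniteMeasure P] {X Y : I → Ω → ℝ}
    (hX : ∀ t, MemLp (X t) 2 P)
    (hY : ∀ t, MemLp (Y t) 2 P) (m n : ℕ) :
    cov[fun ω => haarIntegral (fun t => X t ω) m, fun ω => haarIntegral (fun t => Y t ω) n; P] =
      haarIntegral (fun s => haarIntegral (fun t => cov[X s, Y t; P]) n) m := by
  rw [covariance_haarIntegral_left hX (memLp_haarIntegral hY n)]
  congr 1
  ext s
  rw [covariance_comm, covariance_haarIntegral_left hY (hX s)]
  simp_rw [covariance_comm (Y _)]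

end Moments

/-! ### Hölder regularity of the trajectories -/

theorem IsQWienerProcess.hasGaussianLawWith {H : Type*} [NormedAddCommGroup H]
    [InnerProductSpace ℝ H] [MeasurableSpace H] {Ω : Type*} [MeasurableSpace Ω] {P : Measure Ω}
    {Q : H →L[ℝ] H} {W : I → Ω → H} (hW : IsQWienerProcess Q W P) (t : I) :
    HasGaussianLawWith (W t) 0 ((t : ℝ) • Q) P := by
  have h := hW.gaussianIncrements 0 t t.2.1
  rw [show ((t : ℝ) - ((0 : I) : ℝ)) = t by simp] at h
  refine ⟨(hW.measurable t).aemeasurable, fun x => ?_⟩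
  rw [← h.2 x]
  refine integral_congr_ae ?_
  filter_upwards [hW.zero] with ω hω
  rw [hω, sub_zero]

theorem IsQWienerProcess.measurable_haarCoeff {H : Type*} [NormedAddCommGroup H]
    [InnerProductSpace ℝ H] [SecondCountableTopology H] [MeasurableSpace H] [BorelSpace H]
    {Ω : Type*} [MeasurableSpace Ω] {P : Measure Ω} {Q : H →L[ℝ] H} {W : I → Ω → H} {ι : Type*}
    {e : HilbertBasis ι ℝ H} (hW : IsQWienerProcess Q W P) (p : ι × ℕ) :
    Measurable fun ω => haarCoeff e (fun t => W t ω) p := by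
  have h : ∀ t, Measurable fun ω => ⟪W t ω, e p.1⟫_ℝ := fun t =>
    (hW.measurable t).inner_const
  unfold haarCoeff haarIntegral
  split_ifs
  · exact (h _).sub (h _)
  · exact (((h _).sub (h _)).const_mul _).sub (((h _).sub (h _)).const_mul _)

section Wiener

variable {H : Type*} [NormedAddCommGroup H] [InnerProductSpace ℝ H] [CompleteSpace H]
  [SecondCountableTopology H] [MeasurableSpace H] [BorelSpace H]
  {Ω : Type*} [MeasurableSpace Ω] {P : Measure Ω} [IsProbabilityMeasure P]
  {Q : H →L[ℝ] H} {W : I → Ω → H}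

/-- By Fernique's theorem and scaling, `E ‖W t - W s‖ ^ p` is finite and of order
`|t - s| ^ (p / 2)`. -/
theorem IsQWienerProcess.exists_lintegral_enorm_sub_pow (hW : IsQWienerProcess Q W P)
    (hQ : ∀ h, 0 ≤ ⟪Q h, h⟫_ℝ) (p : ℕ) :
    ∃ M : ℝ≥0∞, M ≠ ∞ ∧ ∀ s t : I, s ≤ t →
      ∫⁻ ω, ‖W t ω - W s ω‖ₑ ^ p ∂P = ENNReal.ofReal √((t : ℝ) - s) ^ p * M := by
  have h01 := hW.gaussianIncrements 0 1 zero_le_one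
  rw [show (((1 : I) : ℝ) - ((0 : I) : ℝ)) • Q = Q by simp] at h01
  have hG : IsGaussian (P.map fun ω => W 1 ω - W 0 ω) := (h01.hasGaussianLaw hQ).isGaussian_map
  refine ⟨∫⁻ x, ‖x‖ₑ ^ p ∂(P.map fun ω => W 1 ω - W 0 ω), ?_, fun s t hst => ?_⟩
  · obtain rfl | hp := Nat.eq_zero_or_pos p
    · simp
    have := IsGaussian.memLp_id (P.map fun ω => W 1 ω - W 0 ω) p (by simp)
    have h2 := lintegral_rpow_enorm_lt_top_of_eLpNorm_lt_top (by simpa using hp.ne') (by simp)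
      this.eLpNorm_lt_top
    simpa using h2.ne
  · have hst' := hW.gaussianIncrements s t hst
    have hmap := h01.map_eq_map_smul (sub_nonneg.2 hst) hst'
    have h1 := lintegral_map' (μ := P) (g := fun ω => W t ω - W s ω)
      (f := fun x : H => ‖x‖ₑ ^ p) (by fun_prop) hst'.1
    rw [← h1, hmap, lintegral_map (by fun_prop) (by fun_prop),
      ← lintegral_const_mul _ (by fun_prop)]
    refine lintegral_congr fun x => ?_
    rw [enorm_smul, mul_pow, Real.enorm_eq_ofReal (Real.sqrt_nonneg _)]

/-- Almost surely, the increments of `W` over all dyadic intervals of length `2 ^ -m` are of order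
`2 ^ (-β m)`: the expectation of the sum of the `p`-th powers of the increments, weighted by
`2 ^ (β m p)`, is a convergent geometric series when `p (1/2 - β) > 1`. -/
theorem IsQWienerProcess.ae_exists_dyadic_bound (hW : IsQWienerProcess Q W P)
    (hQ : ∀ h, 0 ≤ ⟪Q h, h⟫_ℝ) {β : ℝ} (hβ : β < 1 / 2) :
    ∀ᵐ ω ∂P, ∃ K : ℝ, ∀ m j : ℕ, j < 2 ^ m →
      ‖W (dyadicPoint (j + 1) m) ω - W (dyadicPoint j m) ω‖ ≤ K * ((2 : ℝ) ^ (-β)) ^ m := by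
  obtain ⟨p, hp⟩ := exists_nat_gt (1 / (1 / 2 - β))
  have hβ' : 0 < 1 / 2 - β := by linarith
  have hp0 : p ≠ 0 := by
    rintro rfl
    have : 0 < 1 / (1 / 2 - β) := by positivity
    norm_num at hp
    linarith
  rw [div_lt_iff₀ hβ'] at hp
  obtain ⟨M, hM, hMW⟩ := hW.exists_lintegral_enorm_sub_pow hQ p
  set D : ℕ → ℕ → Ω → ℝ≥0∞ := fun m j ω =>
    (ENNReal.ofReal (((2 : ℝ) ^ β) ^ m) *
      ‖W (dyadicPoint (j + 1) m) ω - W (dyadicPoint j m) ω‖ₑ) ^ p with hD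
  have hDm : ∀ m j, Measurable (D m j) := fun m j => by
    have := hW.measurable (dyadicPoint (j + 1) m)
    have := hW.measurable (dyadicPoint j m)
    simp only [hD]
    fun_prop
  set r : ℝ := 2 * (((2 : ℝ) ^ β * (2 : ℝ) ^ (-(1 / 2 : ℝ))) ^ p) with hr
  have hr0 : 0 ≤ r := by positivity
  have hr1 : r < 1 := by
    rw [hr, ← Real.rpow_add (by norm_num), ← Real.rpow_natCast, ← Real.rpow_mul (by norm_num)]
    nth_rewrite 1 [← Real.rpow_one 2]
    rw [← Real.rpow_add (by norm_num)]
    refine Real.rpow_lt_one_of_one_lt_of_neg (by norm_num) ?_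
    nlinarith
  have hDint : ∀ m, ∑ j ∈ Finset.range (2 ^ m), ∫⁻ ω, D m j ω ∂P = ENNReal.ofReal r ^ m * M := by
    intro m
    have : ∀ j ∈ Finset.range (2 ^ m), ∫⁻ ω, D m j ω ∂P =
        ENNReal.ofReal ((((2 : ℝ) ^ β * (2 : ℝ) ^ (-(1 / 2 : ℝ))) ^ p) ^ m) * M := by
      intro j hj
      have hj : j + 1 ≤ 2 ^ m := Finset.mem_range.1 hj
      have hd : (dyadicPoint (j + 1) m : ℝ) - dyadicPoint j m = 1 / 2 ^ m := by
        rw [coe_dyadicPoint hj, coe_dyadicPoint (by omega)]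
        push_cast
        ring
      have hle : dyadicPoint j m ≤ dyadicPoint (j + 1) m := by
        rw [← Subtype.coe_le_coe, ← sub_nonneg, hd]; positivity
      have hsq : √(1 / 2 ^ m : ℝ) = ((2 : ℝ) ^ (-(1 / 2 : ℝ))) ^ m := by
        rw [Real.sqrt_eq_rpow, one_div, Real.inv_rpow (by positivity), ← Real.rpow_natCast 2,
          ← Real.rpow_mul (by norm_num), ← Real.rpow_natCast, ← Real.rpow_mul (by norm_num),
          ← Real.rpow_neg (by norm_num)]
        ring_nf
      simp only [hD, mul_pow]
      have hm1 := hW.measurable (dyadicPoint (j + 1) m)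
      have hm2 := hW.measurable (dyadicPoint j m)
      rw [lintegral_const_mul _ (by fun_prop), hMW _ _ hle, hd, hsq, ← mul_assoc, ← mul_pow,
        ← ENNReal.ofReal_mul (by positivity), ← ENNReal.ofReal_pow (by positivity)]
      congr 2
      rw [← mul_pow, ← mul_pow, ← mul_pow, ← pow_mul, ← pow_mul, mul_comm (_ ^ β), mul_comm p m]
    rw [Finset.sum_congr rfl this, Finset.sum_const, Finset.card_range, nsmul_eq_mul, ← mul_assoc]
    congr 1
    rw [hr, ENNReal.ofReal_mul (by norm_num), mul_pow (ENNReal.ofReal 2),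
      ENNReal.ofReal_pow (by positivity)]
    simp
  have htot : ∫⁻ ω, ∑' m, ∑ j ∈ Finset.range (2 ^ m), D m j ω ∂P ≠ ∞ := by
    rw [lintegral_tsum fun m => (Finset.measurable_fun_sum _ fun j _ => hDm m j).aemeasurable]
    simp_rw [lintegral_finsetSum _ fun j _ => hDm _ j, hDint]
    rw [ENNReal.tsum_mul_right, ENNReal.tsum_geometric]
    refine ENNReal.mul_ne_top (ENNReal.inv_ne_top.2 ?_) hM
    rw [← ENNReal.ofReal_one, ← ENNReal.ofReal_sub _ hr0]
    simpa using hr1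
  have hmeas : Measurable fun ω => ∑' m, ∑ j ∈ Finset.range (2 ^ m), D m j ω :=
    Measurable.tsum fun m => Finset.measurable_fun_sum _ fun j _ => hDm m j
  filter_upwards [ae_lt_top hmeas htot] with ω hω
  refine ⟨1 + (∑' m, ∑ j ∈ Finset.range (2 ^ m), D m j ω).toReal, fun m j hj => ?_⟩
  have h1 : D m j ω ≤ ∑' m, ∑ j ∈ Finset.range (2 ^ m), D m j ω :=
    (Finset.single_le_sum (f := fun j => D m j ω) (fun _ _ => zero_le)
      (Finset.mem_range.2 hj)).trans (ENNReal.le_tsum m)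
  set V := ∑' m, ∑ j ∈ Finset.range (2 ^ m), D m j ω
  set x : ℝ := ((2 : ℝ) ^ β) ^ m * ‖W (dyadicPoint (j + 1) m) ω - W (dyadicPoint j m) ω‖ with hx
  have hx0 : 0 ≤ x := by positivity
  have h2 : x ^ p ≤ V.toReal := by
    have := ENNReal.toReal_mono hω.ne h1
    refine le_trans (le_of_eq ?_) this
    simp only [hD, hx]
    rw [ENNReal.toReal_pow, ENNReal.toReal_mul, toReal_enorm, ENNReal.toReal_ofReal (by positivity)]
  have h3 : x ≤ 1 + V.toReal := by
    obtain h | h := le_total x 1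
    · have : 0 ≤ V.toReal := ENNReal.toReal_nonneg
      linarith
    · have := le_self_pow₀ h hp0
      linarith
  have h4 : ((2 : ℝ) ^ β) ^ m * ((2 : ℝ) ^ (-β)) ^ m = 1 := by
    rw [← mul_pow, ← Real.rpow_add (by norm_num), add_neg_cancel, Real.rpow_zero, one_pow]
  calc ‖W (dyadicPoint (j + 1) m) ω - W (dyadicPoint j m) ω‖ = x * ((2 : ℝ) ^ (-β)) ^ m := by
        rw [hx, mul_right_comm, h4, one_mul]
    _ ≤ _ := by gcongr

/-- Almost all trajectories are Hölder continuous with an exponent strictly between `α` and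
`1 / 2`. -/
theorem IsQWienerProcess.ae_mem_holderZero (hW : IsQWienerProcess Q W P)
    (hQ : ∀ h, 0 ≤ ⟪Q h, h⟫_ℝ) {α : ℝ} (hα : 0 < α) (hα' : α < 1 / 2) :
    ∀ᵐ ω ∂P, (fun t => W t ω) ∈ holderZero H α := by
  have hβ : (α + 1 / 2) / 2 < 1 / 2 := by linarith
  filter_upwards [hW.ae_exists_dyadic_bound hQ hβ, hW.zero, hW.continuous] with ω h1 h2 h3
  obtain ⟨K, hK⟩ := h1
  obtain ⟨C, hC⟩ := exists_holder_of_dyadic (by linarith) h3 hK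
  exact mem_holderZero_of_holder (by linarith) h2 hC

/-! ### Independence of the Haar coefficients -/

theorem IsQWienerProcess.isGaussianProcess (hW : IsQWienerProcess Q W P)
    (hQ : ∀ h, 0 ≤ ⟪Q h, h⟫_ℝ) : IsGaussianProcess W P := by
  refine hW.indepIncrements.isGaussianProcess (fun t => ?_) hW.zero
  refine (hW.hasGaussianLawWith t).hasGaussianLaw fun h => ?_
  rw [smul_apply, real_inner_smul_left]
  exact mul_nonneg t.2.1 (hQ h)

variable {ι : Type*} {e : HilbertBasis ι ℝ H} {lam : ι → ℝ}

theorem IsQWienerProcess.memLp_inner (hW : IsQWienerProcess Q W P)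
    (hQ : ∀ h, 0 ≤ ⟪Q h, h⟫_ℝ) (t : I) (h : H) : MemLp (fun ω => ⟪W t ω, h⟫_ℝ) 2 P :=
  ((hW.isGaussianProcess hQ).hasGaussianLaw_eval t).memLp_two.inner_const h

theorem IsQWienerProcess.covariance_inner_inner [DecidableEq ι] (hW : IsQWienerProcess Q W P)
    (hQ : ∀ h, 0 ≤ ⟪Q h, h⟫_ℝ) (he : ∀ k, Q (e k) = lam k • e k) (k l : ι) (s t : I) :
    cov[fun ω => ⟪W s ω, e k⟫_ℝ, fun ω => ⟪W t ω, e l⟫_ℝ; P] =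
      min (s : ℝ) t * if k = l then lam k else 0 := by
  have hort : ∀ k l, ⟪e k, e l⟫_ℝ = if k = l then 1 else 0 := fun k l =>
    orthonormal_iff_ite.1 e.orthonormal k l
  have hvar : ∀ (s : I) (h : H), Var[fun ω => ⟪W s ω, h⟫_ℝ; P] = s * ⟪Q h, h⟫_ℝ := by
    intro s h
    rw [(hW.hasGaussianLawWith s).variance_inner]
    · rw [smul_apply, real_inner_smul_left]
    · intro h
      rw [smul_apply, real_inner_smul_left]
      exact mul_nonneg s.2.1 (hQ h)
  -- at equal times, by polarization of the variance
  have hdiag : ∀ (k l : ι) (s : I), cov[fun ω => ⟪W s ω, e k⟫_ℝ, fun ω => ⟪W s ω, e l⟫_ℝ; P] =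
      s * if k = l then lam k else 0 := by
    intro k l s
    have h1 := variance_fun_add (hW.memLp_inner hQ s (e k)) (hW.memLp_inner hQ s (e l))
    simp_rw [← inner_add_right] at h1
    rw [hvar, hvar, hvar, map_add, he, he, inner_add_left, inner_add_right, inner_add_right] at h1
    simp only [real_inner_smul_left, hort, if_true] at h1
    by_cases hkl : k = l
    · subst hkl
      simp only [if_true] at h1 ⊢
      linarith
    · simp only [hkl, Ne.symm hkl, if_false] at h1 ⊢
      linarith
  have hle : ∀ (k l : ι) (s t : I), s ≤ t →
      cov[fun ω => ⟪W s ω, e k⟫_ℝ, fun ω => ⟪W t ω, e l⟫_ℝ; P] =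
        s * if k = l then lam k else 0 := by
    intro k l s t hst
    have hdec : (fun ω => ⟪W t ω, e l⟫_ℝ) =
        (fun ω => ⟪W s ω, e l⟫_ℝ) + fun ω => ⟪W t ω - W s ω, e l⟫_ℝ := by
      ext ω
      rw [Pi.add_apply, ← inner_add_left, add_sub_cancel]
    have hmem : MemLp (fun ω => ⟪W t ω - W s ω, e l⟫_ℝ) 2 P := by
      simp_rw [inner_sub_left]
      exact (hW.memLp_inner hQ t _).sub (hW.memLp_inner hQ s _)
    have hind : (W s) ⟂ᵢ[P] (W t - W s) :=
      hW.indepIncrements.indepFun_eval_sub (r := 0) s.2.1 hst hW.zero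
    have hind' : (fun ω => ⟪W s ω, e k⟫_ℝ) ⟂ᵢ[P] (fun ω => ⟪W t ω - W s ω, e l⟫_ℝ) :=
      hind.comp (φ := fun x => ⟪x, e k⟫_ℝ) (ψ := fun x => ⟪x, e l⟫_ℝ) (by fun_prop) (by fun_prop)
    rw [hdec, covariance_add_right (hW.memLp_inner hQ s _) (hW.memLp_inner hQ s _) hmem, hdiag,
      hind'.covariance_eq_zero (hW.memLp_inner hQ s _) hmem, add_zero]
  obtain h | h := le_total s t
  · rw [hle k l s t h, min_eq_left (show (s : ℝ) ≤ t from h)]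
  · rw [covariance_comm, hle l k t s h, min_eq_right (show (t : ℝ) ≤ s from h)]
    by_cases hkl : k = l
    · subst hkl; rfl
    · simp [hkl, Ne.symm hkl]

theorem IsQWienerProcess.covariance_haarCoeff [DecidableEq ι] (hW : IsQWienerProcess Q W P)
    (hQ : ∀ h, 0 ≤ ⟪Q h, h⟫_ℝ) (he : ∀ k, Q (e k) = lam k • e k) (p q : ι × ℕ) :
    cov[fun ω => haarCoeff e (fun t => W t ω) p, fun ω => haarCoeff e (fun t => W t ω) q; P] =
      if p = q then lam p.1 else 0 := by
  unfold haarCoeff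
  rw [covariance_haarIntegral_haarIntegral (fun t => hW.memLp_inner hQ t _)
    (fun t => hW.memLp_inner hQ t _)]
  simp_rw [hW.covariance_inner_inner hQ he]
  rw [haarIntegral_haarIntegral_min]
  by_cases h : p = q
  · subst h; simp
  · rw [if_neg h]
    by_cases h2 : p.2 = q.2
    · have h1 : p.1 ≠ q.1 := fun h1 => h (Prod.ext h1 h2)
      simp [h1]
    · simp [h2]

/-- The Haar coefficients are continuous linear functions of finitely many values of `W`. -/
theorem IsQWienerProcess.isGaussianProcess_haarCoeff (hW : IsQWienerProcess Q W P)
    (hQ : ∀ h, 0 ≤ ⟪Q h, h⟫_ℝ) :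
    IsGaussianProcess (fun (p : ι × ℕ) ω => haarCoeff e (fun t => W t ω) p) P := by
  classical
  refine IsGaussianProcess.of_isGaussianProcess (hW.isGaussianProcess hQ) fun p => ?_
  by_cases hn : p.2 = 0
  · refine ⟨{0, 1}, (innerSL ℝ (e p.1)) ∘L
      (ContinuousLinearMap.proj (R := ℝ) (φ := fun _ => H) ⟨1, by simp⟩ -
        ContinuousLinearMap.proj (R := ℝ) (φ := fun _ => H) ⟨0, by simp⟩), fun ω => ?_⟩
    rw [haarCoeff_eq_inner, real_inner_comm]
    simp [haarIntegral, hn, Finset.restrict, inner_sub_right]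
  · set a := dyadicPoint (2 * (p.2 - 2 ^ Nat.log 2 p.2)) (Nat.log 2 p.2 + 1) with ha
    set b := dyadicPoint (2 * (p.2 - 2 ^ Nat.log 2 p.2) + 1) (Nat.log 2 p.2 + 1) with hb
    set c := dyadicPoint (2 * (p.2 - 2 ^ Nat.log 2 p.2) + 2) (Nat.log 2 p.2 + 1) with hc
    refine ⟨{a, b, c}, (innerSL ℝ (e p.1)) ∘L
      (√((2 : ℝ) ^ Nat.log 2 p.2) •
        (ContinuousLinearMap.proj (R := ℝ) (φ := fun _ => H) ⟨b, by simp⟩ -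
        ContinuousLinearMap.proj (R := ℝ) (φ := fun _ => H) ⟨a, by simp⟩) -
      √((2 : ℝ) ^ Nat.log 2 p.2) •
        (ContinuousLinearMap.proj (R := ℝ) (φ := fun _ => H) ⟨c, by simp⟩ -
        ContinuousLinearMap.proj (R := ℝ) (φ := fun _ => H) ⟨b, by simp⟩)), fun ω => ?_⟩
    rw [haarCoeff_eq_inner, real_inner_comm]
    simp only [haarIntegral, hn, if_false]
    rfl

/-- The Haar coefficients of a Wiener process are independent. -/
theorem IsQWienerProcess.iIndepFun_haarCoeff (hW : IsQWienerProcess Q W P)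
    (hQ : ∀ h, 0 ≤ ⟪Q h, h⟫_ℝ) (he : ∀ k, Q (e k) = lam k • e k) :
    iIndepFun (fun (p : ι × ℕ) ω => haarCoeff e (fun t => W t ω) p) P := by
  classical
  refine iIndepFun_iff_finset.2 fun S => ?_
  refine ((hW.isGaussianProcess_haarCoeff hQ).hasGaussianLaw S).iIndepFun_of_covariance_eq_zero
    fun p q hpq => ?_
  refine (hW.covariance_haarCoeff hQ he p.1 q.1).trans (if_neg fun h => hpq (Subtype.ext h))

theorem IsQWienerProcess.map_haarCoeff (hW : IsQWienerProcess Q W P)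
    (hQ : ∀ h, 0 ≤ ⟪Q h, h⟫_ℝ) (he : ∀ k, Q (e k) = lam k • e k) (p : ι × ℕ) :
    P.map (fun ω => haarCoeff e (fun t => W t ω) p) = gaussianReal 0 (lam p.1).toNNReal := by
  classical
  have h1 := ((hW.isGaussianProcess_haarCoeff (e := e)
    hQ).hasGaussianLaw_eval p).map_eq_gaussianReal
  have h2 : P[fun ω => haarCoeff e (fun t => W t ω) p] = 0 := by
    unfold haarCoeff
    rw [integral_haarIntegral fun t => (hW.memLp_inner hQ t _).integrable (by norm_num)]
    have : ∀ t : I, ∫ ω, ⟪W t ω, e p.1⟫_ℝ ∂P = 0 := fun t =>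
      (hW.hasGaussianLawWith t).integral_inner (fun h => by
        rw [smul_apply, real_inner_smul_left]
        exact mul_nonneg t.2.1 (hQ h)) _
    simp_rw [this]
    simp [haarIntegral]
  have h3 : Var[fun ω => haarCoeff e (fun t => W t ω) p; P] = lam p.1 := by
    rw [← covariance_self (hW.measurable_haarCoeff p).aemeasurable,
      hW.covariance_haarCoeff hQ he, if_pos rfl]
  rw [h1, h2, h3]

end Wiener

/-! ### The infimum of the rate function over a ball -/

/-- Points of an interval of radius `r` about `f` come arbitrarily close to the distance
`max (|f| - r) 0` of the interval from the origin. -/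
theorem exists_abs_sub_lt_and_abs_lt (f : ℝ) {r η : ℝ} (hr : 0 < r) (hη : 0 < η) :
    ∃ y : ℝ, |y - f| < r ∧ |y| < max (|f| - r) 0 + η := by
  obtain h | h := lt_or_ge |f| r
  · refine ⟨0, by simpa using h, ?_⟩
    rw [abs_zero]
    have := le_max_right (|f| - r) 0
    linarith
  · have hm : 0 < min (η / 2) r := lt_min (by linarith) hr
    have hm1 := min_le_left (η / 2) r
    have hm2 := min_le_right (η / 2) r
    have hd := le_max_left (|f| - r) 0
    obtain hf | hf := le_total 0 f
    · rw [abs_of_nonneg hf] at *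
      refine ⟨f - r + min (η / 2) r, ?_, ?_⟩ <;> rw [abs_lt] <;> constructor <;> linarith
    · rw [abs_of_nonpos hf] at *
      refine ⟨f + r - min (η / 2) r, ?_, ?_⟩ <;> rw [abs_lt] <;> constructor <;> linarith

section Infimum

variable {H : Type*} [NormedAddCommGroup H] [InnerProductSpace ℝ H] [CompleteSpace H]
  [TopologicalSpace.SeparableSpace H] [MeasurableSpace H] [BorelSpace H] {ι : Type*}
  (e : HilbertBasis ι ℝ H) {lam : ι → ℝ}

/-- If a Haar coefficient of `F` along the kernel of `Q` has modulus at least the radius of the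
ball, all paths of the ball have infinite energy. -/
theorem iInf_rateFunction_coarseBall_eq_top (h0 : ∀ k, 0 ≤ lam k) {B : ℝ} (hB : ∀ k, lam k ≤ B)
    {α : ℝ} {F : I → H} (hF : F ∈ holderZero H α) {δ : ℝ} (hδ : 0 < δ) {p : ι × ℕ}
    (hp : lam p.1 = 0) (hFp : δ ≤ haarWeight α p.2 * |haarCoeff e F p|) :
    ⨅ G ∈ coarseBall e α δ F, rateFunction e lam G = ⊤ := by
  refine iInf₂_eq_top.2 fun G hG => rateFunction_eq_top e h0 hB hp fun h => ?_
  have := ((mem_coarseBall_iff e hF hδ).1 hG).2 p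
  rw [h, zero_sub, abs_neg] at this
  linarith

/-- The infimum of the energy over the ball is computed coefficientwise: each Haar coefficient
contributes the energy of the point of its closed interval that is closest to zero. Coefficients
outside `S`, and those along the kernel of `Q`, may vanish and contribute nothing. -/
theorem iInf_rateFunction_coarseBall (h0 : ∀ k, 0 ≤ lam k) {B : ℝ} (hB : ∀ k, lam k ≤ B)
    {α : ℝ} (hα : α < 1) {F : I → H} (hF : F ∈ holderZero H α) {δ : ℝ} (hδ : 0 < δ)
    (hker : ∀ p : ι × ℕ, lam p.1 = 0 → haarWeight α p.2 * |haarCoeff e F p| < δ)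
    {S : Finset (ι × ℕ)} (hS : ∀ p ∉ S, haarWeight α p.2 * |haarCoeff e F p| < δ) :
    ⨅ G ∈ coarseBall e α δ F, rateFunction e lam G =
      ENNReal.ofReal (∑ p ∈ S,
        max (|haarCoeff e F p| - δ / haarWeight α p.2) 0 ^ 2 / (2 * lam p.1)) := by
  classical
  have hw := haarWeight_pos α
  apply le_antisymm
  · -- the infimum is bounded by the energy of coefficients within `η` of the optimal ones
    have key : ∀ η : ℝ, 0 < η → ⨅ G ∈ coarseBall e α δ F, rateFunction e lam G ≤
        ENNReal.ofReal (∑ p ∈ S,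
          (max (|haarCoeff e F p| - δ / haarWeight α p.2) 0 + η) ^ 2 / (2 * lam p.1)) := by
      intro η hη
      choose y hy1 hy2 using fun p : ι × ℕ =>
        exists_abs_sub_lt_and_abs_lt (haarCoeff e F p) (div_pos hδ (hw p.2)) hη
      obtain ⟨G, hG, hGS, hGS', hGr⟩ := exists_path_haarCoeff_eq e h0 hB hα S
        (fun p => if lam p.1 = 0 then 0 else y p) (fun p hp => if_pos hp)
      have hGball : G ∈ coarseBall e α δ F := by
        refine (mem_coarseBall_iff e hF hδ).2 ⟨hG, fun p => ?_⟩
        by_cases hp : p ∈ S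
        · rw [hGS p hp]
          by_cases hl : lam p.1 = 0
          · rw [if_pos hl, zero_sub, abs_neg]
            exact hker p hl
          · rw [if_neg hl, mul_comm, ← lt_div_iff₀ (hw p.2)]
            exact hy1 p
        · rw [hGS' p hp, zero_sub, abs_neg]
          exact hS p hp
      refine (iInf₂_le G hGball).trans (hGr.trans (ENNReal.ofReal_le_ofReal ?_))
      refine Finset.sum_le_sum fun p _ => ?_
      have := h0 p.1
      by_cases hl : lam p.1 = 0
      · simp [hl]
      · rw [if_neg hl, ← sq_abs (y p)]
        gcongr
        exact (hy2 p).le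
    have hlim : Tendsto (fun η : ℝ => ENNReal.ofReal (∑ p ∈ S,
          (max (|haarCoeff e F p| - δ / haarWeight α p.2) 0 + η) ^ 2 / (2 * lam p.1)))
        (𝓝[>] 0) (𝓝 (ENNReal.ofReal (∑ p ∈ S,
          max (|haarCoeff e F p| - δ / haarWeight α p.2) 0 ^ 2 / (2 * lam p.1)))) := by
      have hc : Continuous fun η : ℝ => ∑ p ∈ S,
          (max (|haarCoeff e F p| - δ / haarWeight α p.2) 0 + η) ^ 2 / (2 * lam p.1) :=
        continuous_finsetSum _ fun p _ => by fun_prop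
      have h := (ENNReal.continuous_ofReal.comp hc).tendsto 0
      simp only [Function.comp_def, add_zero] at h
      exact h.mono_left nhdsWithin_le_nhds
    exact ge_of_tendsto hlim (eventually_mem_nhdsWithin.mono fun η hη => key η hη)
  · refine le_iInf₂ fun G hG => ?_
    refine le_trans (ENNReal.ofReal_le_ofReal (Finset.sum_le_sum fun p _ => ?_))
      (ofReal_sum_haarCoeff_sq_le_rateFunction e h0 hB G S)
    have := ((mem_coarseBall_iff e hF hδ).1 hG).2 p
    rw [mul_comm, ← lt_div_iff₀ (hw p.2)] at this
    have h1 : |haarCoeff e F p| ≤ |haarCoeff e G p| + |haarCoeff e G p - haarCoeff e F p| := by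
      have := abs_sub_abs_le_abs_sub (haarCoeff e F p) (haarCoeff e G p)
      rw [abs_sub_comm (haarCoeff e F p)] at this
      linarith
    have h2 := h0 p.1
    rw [← sq_abs (haarCoeff e G p)]
    gcongr
    exact max_le (by linarith) (abs_nonneg _)

end Infimum

/-! ### Gaussian probabilities of intervals -/

theorem hasSubgaussianMGF_gaussianReal (v : ℝ≥0) :
    HasSubgaussianMGF (fun x : ℝ => x) v (gaussianReal 0 v) := by
  refine ⟨fun t => integrable_exp_mul_gaussianReal t, fun t => ?_⟩
  have := congr_fun (mgf_fun_id_gaussianReal (μ := 0) (v := v)) t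
  rw [this]
  simp

/-- Chernoff bound for the interval of radius `r` about `f`. -/
theorem gaussianReal_real_le_exp (v : ℝ≥0) (f : ℝ) {r ε : ℝ} (hε : 0 < ε) :
    (gaussianReal 0 v).real {x | |√ε * x - f| < r} ≤
      Real.exp (-(max (|f| - r) 0) ^ 2 / (2 * v) / ε) := by
  have hs : 0 < √ε := Real.sqrt_pos.2 hε
  set d := max (|f| - r) 0 with hd
  have hd0 : 0 ≤ d := le_max_right _ _
  have hexp : -(d / √ε) ^ 2 / (2 * (v : ℝ)) = -d ^ 2 / (2 * v) / ε := by
    rw [div_pow, Real.sq_sqrt hε.le]; ring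
  have hsub := hasSubgaussianMGF_gaussianReal v
  obtain h | h := le_or_gt (|f| - r) 0
  · have : d = 0 := max_eq_right h
    rw [this]
    simp
  · have hdf : d = |f| - r := max_eq_left h.le
    obtain hf | hf := le_total 0 f
    · rw [abs_of_nonneg hf] at hdf
      have h1 := hsub.measure_ge_le (ε := d / √ε) (by positivity)
      rw [hexp] at h1
      refine le_trans (measureReal_mono fun x hx => ?_) h1
      rw [mem_ofPred_eq, abs_lt] at hx
      rw [mem_ofPred_eq, div_le_iff₀ hs]
      linarith
    · rw [abs_of_nonpos hf] at hdf
      have h1 := hsub.neg.measure_ge_le (ε := d / √ε) (by positivity)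
      rw [hexp] at h1
      refine le_trans (measureReal_mono fun x hx => ?_) h1
      rw [mem_ofPred_eq, abs_lt] at hx
      rw [mem_ofPred_eq, div_le_iff₀ hs, Pi.neg_apply]
      linarith

/-- Lower bound up to a loss `η` in the exponent: the interval of radius `r` about `f` contains a
fixed interval of points of modulus less than `max (|f| - r) 0 + η`, on which the density is
explicit. -/
theorem exists_mul_exp_le_gaussianReal_real {v : ℝ≥0} (hv : v ≠ 0) (f : ℝ) {r η : ℝ} (hr : 0 < r)
    (hη : 0 < η) : ∃ κ : ℝ, 0 < κ ∧ ∀ ε : ℝ, 0 < ε → ε ≤ 1 →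
      κ * Real.exp (-(max (|f| - r) 0 + η) ^ 2 / (2 * v) / ε) ≤
        (gaussianReal 0 v).real {x | |√ε * x - f| < r} := by
  set d := max (|f| - r) 0 with hd
  have hd0 : 0 ≤ d := le_max_right _ _
  have hv0 : (0 : ℝ) < v := by positivity
  obtain ⟨y, hy⟩ := exists_abs_sub_lt_and_abs_lt f hr hη
  have hopen : IsOpen {y : ℝ | |y - f| < r ∧ |y| < d + η} :=
    (isOpen_lt (f := fun y : ℝ => |y - f|) (g := fun _ => r) (by fun_prop) (by fun_prop)).and
      (isOpen_lt (f := fun y : ℝ => |y|) (g := fun _ => d + η) (by fun_prop) (by fun_prop))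
  obtain ⟨h, hh, hball⟩ := Metric.isOpen_iff.1 hopen y hy
  have hmem : ∀ z ∈ Icc y (y + h / 2), |z - f| < r ∧ |z| < d + η := by
    intro z hz
    refine hball ?_
    rw [Metric.mem_ball, Real.dist_eq, abs_lt]
    constructor <;> linarith [hz.1, hz.2]
  refine ⟨(√(2 * Real.pi * v))⁻¹ * (h / 2), by positivity, fun ε hε hε1 => ?_⟩
  have hs : 0 < √ε := Real.sqrt_pos.2 hε
  have hs1 : √ε ≤ 1 := Real.sqrt_le_one.2 hε1
  have hsubset : Icc (y / √ε) ((y + h / 2) / √ε) ⊆ {x | |√ε * x - f| < r} := by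
    intro x hx
    refine (hmem (√ε * x) ⟨?_, ?_⟩).1
    · have := hx.1
      rw [div_le_iff₀ hs] at this
      linarith
    · have := hx.2
      rw [le_div_iff₀ hs] at this
      linarith
  refine le_trans ?_ (measureReal_mono hsubset)
  have hlow : ∀ x ∈ Icc (y / √ε) ((y + h / 2) / √ε),
      (√(2 * Real.pi * v))⁻¹ * Real.exp (-(d + η) ^ 2 / (2 * v) / ε) ≤ gaussianPDFReal 0 v x := by
    intro x hx
    rw [gaussianPDFReal]
    have hz := (hmem (√ε * x) ⟨by have := hx.1; rw [div_le_iff₀ hs] at this; linarith,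
      by have := hx.2; rw [le_div_iff₀ hs] at this; linarith⟩).2
    have hsq : ε * x ^ 2 ≤ (d + η) ^ 2 := by
      have := pow_le_pow_left₀ (abs_nonneg _) hz.le 2
      rwa [sq_abs, mul_pow, Real.sq_sqrt hε.le] at this
    have hle : x ^ 2 ≤ (d + η) ^ 2 / ε := by
      rw [le_div_iff₀ hε]; linarith
    refine mul_le_mul_of_nonneg_left (Real.exp_le_exp.2 ?_) (by positivity)
    rw [sub_zero, neg_div, neg_div, neg_div, neg_le_neg_iff]
    calc x ^ 2 / (2 * (v : ℝ)) ≤ (d + η) ^ 2 / ε / (2 * v) := by gcongr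
      _ = _ := div_right_comm _ _ _
  have hle : y / √ε ≤ (y + h / 2) / √ε := by gcongr; linarith
  rw [Measure.real, gaussianReal_apply_eq_integral _ hv, ENNReal.toReal_ofReal
    (integral_nonneg fun x => gaussianPDFReal_nonneg _ _ _)]
  have hconst : (√(2 * Real.pi * v))⁻¹ * Real.exp (-(d + η) ^ 2 / (2 * v) / ε) *
      ((y + h / 2) / √ε - y / √ε) ≤
      ∫ x in Icc (y / √ε) ((y + h / 2) / √ε), gaussianPDFReal 0 v x := by
    have h1 := setIntegral_mono_on (μ := volume) (s := Icc (y / √ε) ((y + h / 2) / √ε))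
      (f := fun _ => (√(2 * Real.pi * v))⁻¹ * Real.exp (-(d + η) ^ 2 / (2 * v) / ε))
      (g := gaussianPDFReal 0 v) (integrableOn_const (by simp))
      (integrable_gaussianPDFReal 0 v).integrableOn measurableSet_Icc hlow
    refine le_trans (le_of_eq ?_) h1
    rw [setIntegral_const, smul_eq_mul, mul_comm]
    congr 1
    rw [Real.volume_real_Icc_of_le hle]
  refine le_trans ?_ hconst
  have hlen : h / 2 ≤ (y + h / 2) / √ε - y / √ε := by
    rw [← sub_div, add_sub_cancel_left, le_div_iff₀ hs]
    nlinarith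
  calc _ = (√(2 * Real.pi * v))⁻¹ * Real.exp (-(d + η) ^ 2 / (2 * v) / ε) * (h / 2) := by ring
    _ ≤ _ := by gcongr

/-- The large deviation asymptotics of a scaled centered Gaussian variable on an open interval. In
the degenerate case `v = 0` the rate is `0` thanks to the convention `x / 0 = 0`. -/
theorem tendsto_mul_log_gaussianReal {v : ℝ≥0} {f r : ℝ} (hr : 0 < r) (hv : v = 0 → |f| < r) :
    (∀ᶠ ε in 𝓝[>] (0 : ℝ), 0 < (gaussianReal 0 v).real {x | |√ε * x - f| < r}) ∧
    Tendsto (fun ε : ℝ => ε * Real.log ((gaussianReal 0 v).real {x | |√ε * x - f| < r}))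
      (𝓝[>] 0) (𝓝 (-(max (|f| - r) 0 ^ 2 / (2 * v)))) := by
  obtain rfl | hv0 := eq_or_ne v 0
  · have h1 : ∀ ε : ℝ, (gaussianReal 0 0).real {x | |√ε * x - f| < r} = 1 := by
      intro ε
      rw [gaussianReal_zero_var, Measure.real, Measure.dirac_apply_of_mem]
      · simp
      · simpa using hv rfl
    simp_rw [h1]
    simp
  set d := max (|f| - r) 0 with hd
  have hIoc : ∀ᶠ ε in 𝓝[>] (0 : ℝ), ε ∈ Ioc (0 : ℝ) 1 := Ioc_mem_nhdsGT one_pos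
  have hpos : ∀ᶠ ε in 𝓝[>] (0 : ℝ), 0 < (gaussianReal 0 v).real {x | |√ε * x - f| < r} := by
    obtain ⟨κ, hκ, hκ'⟩ := exists_mul_exp_le_gaussianReal_real hv0 f hr one_pos
    filter_upwards [hIoc] with ε hε
    exact lt_of_lt_of_le (by positivity) (hκ' ε hε.1 hε.2)
  refine ⟨hpos, tendsto_order.2 ⟨fun a ha => ?_, fun a ha => ?_⟩⟩
  · -- choose the loss `η` so small that the exponent stays above `a`
    have hc : Tendsto (fun η : ℝ => -((d + η) ^ 2 / (2 * (v : ℝ)))) (𝓝[>] 0)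
        (𝓝 (-(d ^ 2 / (2 * (v : ℝ))))) := by
      have hcont : Continuous fun η : ℝ => -((d + η) ^ 2 / (2 * (v : ℝ))) := by fun_prop
      have := hcont.tendsto 0
      rw [add_zero] at this
      exact this.mono_left nhdsWithin_le_nhds
    obtain ⟨η, hηa, hη⟩ := ((hc.eventually (lt_mem_nhds ha)).and eventually_mem_nhdsWithin).exists
    obtain ⟨κ, hκ, hκ'⟩ := exists_mul_exp_le_gaussianReal_real hv0 f hr hη
    have hlim : Tendsto (fun ε : ℝ => ε * Real.log κ - (d + η) ^ 2 / (2 * (v : ℝ))) (𝓝[>] 0)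
        (𝓝 (-((d + η) ^ 2 / (2 * (v : ℝ))))) := by
      have hcont : Continuous fun ε : ℝ => ε * Real.log κ - (d + η) ^ 2 / (2 * (v : ℝ)) := by
        fun_prop
      have := hcont.tendsto 0
      rw [zero_mul, zero_sub] at this
      exact this.mono_left nhdsWithin_le_nhds
    filter_upwards [hlim.eventually (lt_mem_nhds hηa), hIoc] with ε h1 h2
    refine h1.trans_le ?_
    have h3 := Real.log_le_log (by positivity) (hκ' ε h2.1 h2.2)
    rw [Real.log_mul hκ.ne' (Real.exp_pos _).ne', Real.log_exp] at h3
    have h4 := mul_le_mul_of_nonneg_left h3 h2.1.le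
    refine le_trans (le_of_eq ?_) h4
    have := h2.1.ne'
    field_simp
    ring
  · filter_upwards [hpos, hIoc] with ε h1 h2
    refine lt_of_le_of_lt ?_ ha
    have h3 := Real.log_le_log h1 (gaussianReal_real_le_exp v f h2.1)
    rw [Real.log_exp] at h3
    have h4 := mul_le_mul_of_nonneg_left h3 h2.1.le
    refine h4.trans (le_of_eq ?_)
    rw [mul_div_cancel₀ _ h2.1.ne', neg_div]

/-! ### Probabilities of balls -/

section Events

variable {H : Type*} [NormedAddCommGroup H] [InnerProductSpace ℝ H] {Ω : Type*} {ι : Type*}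

/-- The event that the Haar coefficient `p` of `√ε W` lies within the radius of the ball
about `F` from that of `F`. -/
def coeffEvent (e : HilbertBasis ι ℝ H) (W : I → Ω → H) (α δ : ℝ) (F : I → H) (ε : ℝ)
    (p : ι × ℕ) : Set Ω :=
  (fun ω => haarCoeff e (fun t => W t ω) p) ⁻¹'
    {x | |√ε * x - haarCoeff e F p| < δ / haarWeight α p.2}

/-- The event that the weighted Haar coefficients of `W` outside `S` are bounded by `M`. -/
def tailEvent (e : HilbertBasis ι ℝ H) (W : I → Ω → H) (α M : ℝ) (S : Set (ι × ℕ)) : Set Ω :=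
  ⋂ p ∈ Sᶜ, (fun ω => haarCoeff e (fun t => W t ω) p) ⁻¹' {x | haarWeight α p.2 * |x| ≤ M}

/-- The σ-algebra generated by the Haar coefficient `p` of `W`. -/
noncomputable abbrev coeffSigma (e : HilbertBasis ι ℝ H) (W : I → Ω → H) (p : ι × ℕ) :
    MeasurableSpace Ω :=
  MeasurableSpace.comap (fun ω => haarCoeff e (fun t => W t ω) p) inferInstance

variable {e : HilbertBasis ι ℝ H} {W : I → Ω → H}

theorem measurableSet_setOf_abs_lt (a f r : ℝ) : MeasurableSet {x : ℝ | |a * x - f| < r} :=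
  measurableSet_lt (by fun_prop) (by fun_prop)

theorem measurableSet_iInter_coeffEvent (α δ : ℝ) (F : I → H) (ε : ℝ) (S : Finset (ι × ℕ)) :
    MeasurableSet[⨆ p ∈ (S : Set (ι × ℕ)), coeffSigma e W p]
      (⋂ p ∈ S, coeffEvent e W α δ F ε p) := by
  refine S.measurableSet_biInter fun p hp => ?_
  refine (le_iSup₂ (f := fun (p : ι × ℕ) (_ : p ∈ (S : Set (ι × ℕ))) => coeffSigma e W p) p hp) _ ?_
  exact ⟨_, measurableSet_setOf_abs_lt _ _ _, rfl⟩

theorem measurableSet_tailEvent [Countable ι] (α M : ℝ) (S : Set (ι × ℕ)) :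
    MeasurableSet[⨆ p ∈ Sᶜ, coeffSigma e W p] (tailEvent e W α M S) := by
  refine MeasurableSet.biInter (to_countable _) fun p hp => ?_
  refine (le_iSup₂ (f := fun (p : ι × ℕ) (_ : p ∈ Sᶜ) => coeffSigma e W p) p hp) _ ?_
  exact ⟨_, measurableSet_le (by fun_prop) (by fun_prop), rfl⟩

theorem smul_mem_coarseBall_iff {α δ : ℝ} (hδ : 0 < δ) {F : I → H} (hF : F ∈ holderZero H α)
    {ω : Ω} (hω : (fun t => W t ω) ∈ holderZero H α) (ε : ℝ) :
    (fun t => √ε • W t ω) ∈ coarseBall e α δ F ↔ ∀ p, ω ∈ coeffEvent e W α δ F ε p := by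
  rw [mem_coarseBall_iff e hF hδ]
  refine (and_iff_right (smul_mem_holderZero hω _)).trans (forall_congr' fun p => ?_)
  rw [haarCoeff_smul, mul_comm, ← lt_div_iff₀ (haarWeight_pos α p.2)]
  rfl

end Events

section Ball

variable {H : Type*} [NormedAddCommGroup H] [InnerProductSpace ℝ H] [CompleteSpace H]
  [SecondCountableTopology H] [MeasurableSpace H] [BorelSpace H]
  {Ω : Type*} [MeasurableSpace Ω] {P : Measure Ω} [IsProbabilityMeasure P]
  {Q : H →L[ℝ] H} {W : I → Ω → H} {ι : Type*} {e : HilbertBasis ι ℝ H} {lam : ι → ℝ}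

theorem IsQWienerProcess.measure_coeffEvent (hW : IsQWienerProcess Q W P)
    (hQ : ∀ h, 0 ≤ ⟪Q h, h⟫_ℝ) (he : ∀ k, Q (e k) = lam k • e k) (α δ : ℝ) (F : I → H) (ε : ℝ)
    (p : ι × ℕ) :
    P (coeffEvent e W α δ F ε p) = gaussianReal 0 (lam p.1).toNNReal
      {x | |√ε * x - haarCoeff e F p| < δ / haarWeight α p.2} := by
  rw [← hW.map_haarCoeff hQ he p,
    Measure.map_apply (hW.measurable_haarCoeff p) (measurableSet_setOf_abs_lt _ _ _)]
  rfl

theorem IsQWienerProcess.scaledLaw_le (hW : IsQWienerProcess Q W P)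
    (hQ : ∀ h, 0 ≤ ⟪Q h, h⟫_ℝ) {α : ℝ} (hα : 0 < α) (hα' : α < 1 / 2) {δ : ℝ} (hδ : 0 < δ)
    {F : I → H} (hF : F ∈ holderZero H α) (S : Finset (ι × ℕ)) (ε : ℝ) :
    scaledLaw W P ε (coarseBall e α δ F) ≤ P (⋂ p ∈ S, coeffEvent e W α δ F ε p) := by
  refine measure_mono_ae ?_
  filter_upwards [hW.ae_mem_holderZero hQ hα hα'] with ω hω hmem
  refine mem_iInter₂.2 fun p _ => ?_
  exact (smul_mem_coarseBall_iff hδ hF hω ε).1 hmem p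

theorem IsQWienerProcess.measure_iInter_coeffEvent (hW : IsQWienerProcess Q W P)
    (hQ : ∀ h, 0 ≤ ⟪Q h, h⟫_ℝ) (he : ∀ k, Q (e k) = lam k • e k) (α δ : ℝ) (F : I → H) (ε : ℝ)
    (S : Finset (ι × ℕ)) :
    P (⋂ p ∈ S, coeffEvent e W α δ F ε p) = ∏ p ∈ S, P (coeffEvent e W α δ F ε p) :=
  (hW.iIndepFun_haarCoeff hQ he).measure_inter_preimage_eq_mul S
    (fun _ _ => measurableSet_setOf_abs_lt _ _ _)

theorem IsQWienerProcess.indep_coeffSigma (hW : IsQWienerProcess Q W P)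
    (hQ : ∀ h, 0 ≤ ⟪Q h, h⟫_ℝ) (he : ∀ k, Q (e k) = lam k • e k) (S : Set (ι × ℕ)) :
    Indep (⨆ p ∈ S, coeffSigma e W p) (⨆ p ∈ Sᶜ, coeffSigma e W p) P :=
  indep_iSup_of_disjoint (fun p => (hW.measurable_haarCoeff (e := e) p).comap_le)
    (hW.iIndepFun_haarCoeff hQ he) disjoint_compl_right

/-- The weighted Haar coefficients of `W` are almost surely bounded because the trajectories lie in
`C_α^0`; hence they are bounded by a constant with probability close to one. -/
theorem IsQWienerProcess.exists_half_le_measure_tailEvent (hW : IsQWienerProcess Q W P)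
    (hQ : ∀ h, 0 ≤ ⟪Q h, h⟫_ℝ) {α : ℝ} (hα : 0 < α) (hα' : α < 1 / 2) (S : Set (ι × ℕ)) :
    ∃ N : ℕ, 1 / 2 ≤ P (tailEvent e W α N S) := by
  have hmono : Monotone fun N : ℕ => tailEvent e W α N S := by
    intro M N hMN
    refine iInter₂_mono fun p _ => preimage_mono fun x hx => ?_
    exact le_trans (show _ ≤ (M : ℝ) from hx) (Nat.cast_le.2 hMN)
  have hfull : P (⋃ N : ℕ, tailEvent e W α N S) = 1 := by
    refine (measure_congr (eventuallyEq_univ.2 ?_)).trans measure_univ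
    filter_upwards [hW.ae_mem_holderZero hQ hα hα'] with ω hω
    obtain ⟨M, hM⟩ := exists_haarCoeff_le e hω
    obtain ⟨N, hN⟩ := exists_nat_ge M
    exact mem_iUnion.2 ⟨N, mem_iInter₂.2 fun p _ => (hM p).trans hN⟩
  have hlim := tendsto_measure_iUnion_atTop (μ := P) hmono
  rw [hfull] at hlim
  have h : (1 / 2 : ℝ≥0∞) < 1 := by
    rw [one_div]; exact ENNReal.one_half_lt_one
  obtain ⟨N, hN⟩ := (hlim.eventually (lt_mem_nhds h)).exists
  exact ⟨N, hN.le⟩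

/-- On the event in which the finitely many coefficients of `√ε W` in `S` are within the radius and
those of `W` outside `S` are at most `M`, the path `√ε W` lies in the ball once `√ε M < δ / 2`; the
two conditions are independent. -/
theorem IsQWienerProcess.le_scaledLaw [Countable ι] (hW : IsQWienerProcess Q W P)
    (hQ : ∀ h, 0 ≤ ⟪Q h, h⟫_ℝ) (he : ∀ k, Q (e k) = lam k • e k) {α : ℝ} (hα : 0 < α)
    (hα' : α < 1 / 2) {δ : ℝ} (hδ : 0 < δ)
    {F : I → H} (hF : F ∈ holderZero H α) {S : Finset (ι × ℕ)}
    (hS : ∀ p ∉ S, haarWeight α p.2 * |haarCoeff e F p| < δ / 2) {M ε : ℝ}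
    (hε : √ε * M < δ / 2) :
    P (⋂ p ∈ S, coeffEvent e W α δ F ε p) * P (tailEvent e W α M S) ≤
      scaledLaw W P ε (coarseBall e α δ F) := by
  have hind : Indep (⨆ p ∈ (S : Set (ι × ℕ)), coeffSigma e W p)
    (⨆ p ∈ (S : Set (ι × ℕ))ᶜ, coeffSigma e W p) P := hW.indep_coeffSigma hQ he S
  have hmul : P ((⋂ p ∈ S, coeffEvent e W α δ F ε p) ∩ tailEvent e W α M S) =
      P (⋂ p ∈ S, coeffEvent e W α δ F ε p) * P (tailEvent e W α M S) := by
    rw [Indep_iff] at hind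
    have h1 := measurableSet_iInter_coeffEvent (e := e) (W := W) α δ F ε S
    have h2 := measurableSet_tailEvent (e := e) (W := W) α M (S : Set (ι × ℕ))
    exact hind _ _ h1 h2
  rw [← hmul]
  refine measure_mono_ae ?_
  filter_upwards [hW.ae_mem_holderZero hQ hα hα'] with ω hω hmem
  refine (smul_mem_coarseBall_iff hδ hF hω ε).2 fun p => ?_
  by_cases hp : p ∈ S
  · exact mem_iInter₂.1 hmem.1 p hp
  · have h1 : haarWeight α p.2 * |haarCoeff e (fun t => W t ω) p| ≤ M :=
      mem_iInter₂.1 hmem.2 p hp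
    have h2 := hS p hp
    change |√ε * haarCoeff e (fun t => W t ω) p - haarCoeff e F p| < δ / haarWeight α p.2
    have hw := haarWeight_pos α p.2
    rw [lt_div_iff₀ hw]
    have h3 := abs_sub (√ε * haarCoeff e (fun t => W t ω) p) (haarCoeff e F p)
    rw [abs_mul, abs_of_nonneg (Real.sqrt_nonneg ε)] at h3
    have h4 := mul_le_mul_of_nonneg_left h1 (Real.sqrt_nonneg ε)
    calc _ ≤ (√ε * |haarCoeff e (fun t => W t ω) p| + |haarCoeff e F p|) * haarWeight α p.2 :=
          mul_le_mul_of_nonneg_right h3 hw.le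
      _ = √ε * (haarWeight α p.2 * |haarCoeff e (fun t => W t ω) p|) +
          haarWeight α p.2 * |haarCoeff e F p| := by ring
      _ < δ := by linarith

end Ball

theorem mainTheorem3 {H : Type u} [NormedAddCommGroup H] [InnerProductSpace ℝ H]
    [CompleteSpace H] [TopologicalSpace.SeparableSpace H] [MeasurableSpace H] [BorelSpace H]
    {ι : Type v} [Countable ι]
    (Q : H →L[ℝ] H) (hQ : IsPositiveTraceClass.{u, v} Q)
    (e : HilbertBasis ι ℝ H) (lam : ι → ℝ) (he : ∀ k, Q (e k) = lam k • e k)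
    {Ω : Type*} [MeasurableSpace Ω] (P : Measure Ω) [IsProbabilityMeasure P]
    (W : I → Ω → H) (hW : IsQWienerProcess Q W P)
    (α : ℝ) (hα : 0 < α) (hα' : α < 1 / 2)
    (F : I → H) (hF : F ∈ holderZero H α) (δ : ℝ) (hδ : 0 < δ) :
    Tendsto (fun ε : ℝ => (ε : EReal) * ENNReal.log (scaledLaw W P ε (coarseBall e α δ F)))
      (𝓝[>] 0)
      (𝓝 (-((⨅ G ∈ coarseBall e α δ F, rateFunction e lam G : ℝ≥0∞) : EReal))) := by
  have : SecondCountableTopology H := UniformSpace.secondCountable_of_separable H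
  have hQpos : ∀ h, 0 ≤ ⟪Q h, h⟫_ℝ := fun h => hQ.1.inner_nonneg_left h
  have hlam : ∀ k, ⟪Q (e k), e k⟫_ℝ = lam k := fun k => by
    rw [he, real_inner_smul_left, real_inner_self_eq_norm_sq, e.orthonormal.1]; norm_num
  have h0 : ∀ k, 0 ≤ lam k := fun k => hlam k ▸ hQpos (e k)
  have hB : ∀ k, lam k ≤ ‖Q‖ := fun k => by
    rw [← hlam k]
    refine (real_inner_le_norm _ _).trans ?_
    have := Q.le_opNorm (e k)
    rwa [e.orthonormal.1, mul_one] at this ⊢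
  by_cases hker : ∀ p : ι × ℕ, lam p.1 = 0 → haarWeight α p.2 * |haarCoeff e F p| < δ
  · have hfin := finite_setOf_le_haarCoeff e hF (half_pos hδ)
    set S := hfin.toFinset with hSdef
    have hS : ∀ p ∉ S, haarWeight α p.2 * |haarCoeff e F p| < δ / 2 := by
      intro p hp
      by_contra hc
      refine hp (hfin.mem_toFinset.2 ?_)
      rw [mem_ofPred_eq, abs_mul, abs_of_pos (haarWeight_pos α p.2)]
      exact not_lt.1 hc
    -- both sides are computed by the finitely many coefficients in `S`
    rw [iInf_rateFunction_coarseBall e h0 hB (by linarith) hF hδ hker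
      (fun p hp => (hS p hp).trans (by linarith))]
    set J := ∑ p ∈ S, max (|haarCoeff e F p| - δ / haarWeight α p.2) 0 ^ 2 / (2 * lam p.1) with hJ
    have hJ0 : 0 ≤ J := Finset.sum_nonneg fun p _ => by have := h0 p.1; positivity
    rw [EReal.coe_ennreal_ofReal, max_eq_left hJ0, ← EReal.coe_neg]
    have hr : ∀ p : ι × ℕ, 0 < δ / haarWeight α p.2 := fun p => div_pos hδ (haarWeight_pos α p.2)
    have h1d := fun p : ι × ℕ => tendsto_mul_log_gaussianReal (v := (lam p.1).toNNReal)
      (f := haarCoeff e F p) (hr p) (fun hv => by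
        rw [lt_div_iff₀ (haarWeight_pos α p.2), mul_comm]
        exact hker p (le_antisymm (Real.toNNReal_eq_zero.1 hv) (h0 p.1)))
    set q : ι × ℕ → ℝ → ℝ := fun p ε => (gaussianReal 0 (lam p.1).toNNReal).real
      {x | |√ε * x - haarCoeff e F p| < δ / haarWeight α p.2} with hq
    have hlim : Tendsto (fun ε => ∑ p ∈ S, ε * Real.log (q p ε)) (𝓝[>] 0) (𝓝 (-J)) := by
      rw [hJ, ← Finset.sum_neg_distrib]
      refine tendsto_finsetSum _ fun p _ => ?_
      have := (h1d p).2
      rwa [Real.coe_toNNReal _ (h0 p.1)] at this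
    have hpos : ∀ᶠ ε in 𝓝[>] (0 : ℝ), ∀ p ∈ S, 0 < q p ε :=
      (Finset.eventually_all S).2 fun p _ => (h1d p).1
    have hprod : ∀ ε, P (⋂ p ∈ S, coeffEvent e W α δ F ε p) =
        ENNReal.ofReal (∏ p ∈ S, q p ε) := by
      intro ε
      rw [hW.measure_iInter_coeffEvent hQpos he, ENNReal.ofReal_prod_of_nonneg
        fun p _ => measureReal_nonneg]
      refine Finset.prod_congr rfl fun p _ => ?_
      rw [hW.measure_coeffEvent hQpos he, ofReal_measureReal]
    obtain ⟨N, hN⟩ := hW.exists_half_le_measure_tailEvent (e := e) hQpos hα hα' S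
    have hhalf : (1 / 2 : ℝ≥0∞) = ENNReal.ofReal (1 / 2) := by
      rw [ENNReal.ofReal_div_of_pos (by norm_num)]; simp
    have hlow : Tendsto (fun ε => ∑ p ∈ S, ε * Real.log (q p ε) + ε * Real.log (1 / 2)) (𝓝[>] 0)
        (𝓝 (-J)) := by
      have h2 : Tendsto (fun ε : ℝ => ε * Real.log (1 / 2)) (𝓝[>] 0) (𝓝 0) := by
        have hcont : Continuous fun ε : ℝ => ε * Real.log (1 / 2) := by fun_prop
        have := hcont.tendsto 0
        rw [zero_mul] at this
        exact this.mono_left nhdsWithin_le_nhds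
      simpa using hlim.add h2
    have hsmall : ∀ᶠ ε in 𝓝[>] (0 : ℝ), √ε * (N : ℝ) < δ / 2 := by
      have hcont : Continuous fun ε : ℝ => √ε * (N : ℝ) := by fun_prop
      have := hcont.tendsto 0
      rw [Real.sqrt_zero, zero_mul] at this
      exact (this.mono_left nhdsWithin_le_nhds).eventually (gt_mem_nhds (half_pos hδ))
    refine tendsto_of_tendsto_of_tendsto_of_le_of_le'
      ((continuous_coe_real_ereal.tendsto _).comp hlow)
      ((continuous_coe_real_ereal.tendsto _).comp hlim) ?_ ?_
    · filter_upwards [hpos, hsmall, eventually_mem_nhdsWithin] with ε h1 h2 h3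
      have h3 : 0 < ε := h3
      have hle : ENNReal.ofReal ((∏ p ∈ S, q p ε) * (1 / 2)) ≤
          scaledLaw W P ε (coarseBall e α δ F) := by
        refine le_trans ?_ (hW.le_scaledLaw hQpos he hα hα' hδ hF hS h2)
        rw [hprod, ENNReal.ofReal_mul (Finset.prod_nonneg fun p hp => (h1 p hp).le), ← hhalf]
        gcongr
      have hp0 : 0 < ∏ p ∈ S, q p ε := Finset.prod_pos h1
      have hlog := ENNReal.log_le_log hle
      rw [ENNReal.log_ofReal_of_pos (by positivity), Real.log_mul hp0.ne' (by norm_num),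
        Real.log_prod fun p hp => (h1 p hp).ne'] at hlog
      refine le_trans (le_of_eq ?_) (mul_le_mul_of_nonneg_left hlog (EReal.coe_nonneg.2 h3.le))
      rw [← EReal.coe_mul, mul_add, Finset.mul_sum]
      rfl
    · filter_upwards [hpos, eventually_mem_nhdsWithin] with ε h1 h3
      have h3 : 0 < ε := h3
      have hle := hW.scaledLaw_le (e := e) hQpos hα hα' hδ hF S ε
      rw [hprod] at hle
      have hp0 : 0 < ∏ p ∈ S, q p ε := Finset.prod_pos h1
      have hlog := ENNReal.log_le_log hle
      rw [ENNReal.log_ofReal_of_pos hp0, Real.log_prod fun p hp => (h1 p hp).ne'] at hlog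
      refine le_trans (mul_le_mul_of_nonneg_left hlog (EReal.coe_nonneg.2 h3.le)) (le_of_eq ?_)
      rw [← EReal.coe_mul, Finset.mul_sum]
      rfl
  · push Not at hker
    obtain ⟨p, hp, hFp⟩ := hker
    rw [iInf_rateFunction_coarseBall_eq_top e h0 hB hF hδ hp hFp, EReal.coe_ennreal_top,
      EReal.neg_top]
    refine tendsto_const_nhds.congr' ?_
    filter_upwards [eventually_mem_nhdsWithin] with ε hε
    -- the `p`-th coefficient of `W` vanishes almost surely, that of `F` is too large
    have hzero : scaledLaw W P ε (coarseBall e α δ F) = 0 := by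
      refine le_antisymm ((hW.scaledLaw_le (e := e) hQpos hα hα' hδ hF {p} ε).trans ?_) zero_le
      rw [hW.measure_iInter_coeffEvent hQpos he, Finset.prod_singleton,
        hW.measure_coeffEvent hQpos he, hp, Real.toNNReal_zero, gaussianReal_zero_var,
        Measure.dirac_apply' _ (measurableSet_setOf_abs_lt _ _ _), indicator_of_notMem]
      rw [mem_ofPred_eq, mul_zero, zero_sub, abs_neg, not_lt, div_le_iff₀ (haarWeight_pos α p.2),
        mul_comm]
      exact hFp
    rw [hzero, ENNReal.log_zero, EReal.coe_mul_bot_of_pos hε]
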